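/- All spaces are Tychonoff (completely regular Hausdorff). A topological group $G$ is *$\omega$-narrow* if for every neighbourhood $U$ of the neutral element there is a countable set $A\subset G$ with $UA=AU=G$. An action of $G$ on $X$ is *separately continuous* if all maps $x\mapsto gx$ $(g\in G)$ and $g\mapsto gx$ $(x\in X)$ are continuous. A compact space $K$ is *Dugundji* if for every embedding $i$ of $K$ in a compact space $Y$ there is a linear operator $E:C(K)\to C(Y)$ with $E(1)=1$, $E(f)\ge 0$ whenever $f\ge 0$, and $E(f)\circ i=f$ for all $f\in C(K)$. A space $X$ is *openly Dugundji* if there are a nonzero cardinal $\tau$ and an inverse system $S=\{X_\alpha,p^\beta_\alpha,\alpha\le\beta<\tau\}$ of spaces with continuous open surjective bonding maps $p^\beta_\alpha:X_\beta\to X_\alpha$ such that 1. $X_0$ is separable metrizable, and for each $\alpha$ with $\alpha+1<\tau$ there are a separable metrizable space $M_\alpha$ and an embedding of $X_{\alpha+1}$ in $X_\alpha\times M_\alpha$ under which $p^{\alpha+1}_\alpha$ is the restriction of the projection onto $X_\alpha$; 2. for each limit ordinal $\gamma<\tau$ the canonical map $X_\gamma\to\varprojlim\{X_\alpha,p^\beta_\alpha,\alpha\le\beta<\gamma\}$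 is an embedding with dense image; 3. $X$ embeds in $\varprojlim S$ in such a way that $p_\alpha(X)=X_\alpha$ for all $\alpha<\tau$, where $p_\alpha:\varprojlim S\to X_\alpha$ is the limit projection; 4. every bounded continuous $f:\varprojlim S\to\mathbb R$ has the form $f=g\circ p_\alpha$ for some $\alpha<\tau$ and some continuous $g:X_\alpha\to\mathbb R$. **Proposition 1.6.** Let an $\omega$-narrow topological group $G$ act transitively on a nonempty space $X$ by a separately continuous action $\theta:G\times X\to X$. (a) If $X$ is pseudocompact, then $\theta$ is continuous and the Stone–Čech compactification $\beta X$ is a Dugundji space. (b) If $X$ is Čech-complete and $\sigma$-compact, then $\theta$ is continuous and $X$ is openly Dugundji. -/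

import Mathlib

universe u v

/-- A group with a topology is `ω`-narrow if every neighbourhood `U` of the neutral element
admits a countable set `A` with `U * A = A * U = G`. -/
def IsOmegaNarrow (G : Type v) [Group G] [TopologicalSpace G] : Prop :=
  ∀ U ∈ nhds (1 : G), ∃ A : Set G, A.Countable ∧
    (∀ g : G, ∃ x ∈ U, ∃ a ∈ A, x * a = g) ∧ (∀ g : G, ∃ a ∈ A, ∃ x ∈ U, a * x = g)

/-- An action is separately continuous if all translations `x ↦ g • x` and all orbit maps
`g ↦ g • x` are continuous. -/
def IsSeparatelyContinuousAction (G : Type v) (X : Type u) [Group G] [TopologicalSpace G]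
    [TopologicalSpace X] [MulAction G X] : Prop :=
  (∀ g : G, Continuous fun x : X => g • x) ∧ (∀ x : X, Continuous fun g : G => g • x)

/-- A Tychonoff space is pseudocompact if every continuous real-valued function on it is
bounded. -/
def IsPseudocompact (X : Type u) [TopologicalSpace X] : Prop :=
  T35Space X ∧ ∀ f : X → ℝ, Continuous f → ∃ C : ℝ, ∀ x, |f x| ≤ C

/-- A Tychonoff space is Čech-complete if it is a `Gδ`-set in its Stone–Čech
compactification. -/
def IsCechComplete (X : Type u) [TopologicalSpace X] : Prop :=
  T35Space X ∧ IsGδ (Set.range (stoneCechUnit : X → StoneCech X))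

/-- A Dugundji space: a compact Hausdorff space `K` such that for every embedding `i` of `K` in
a compact Hausdorff space `Y` there is a regular (linear, positive, sending `1` to `1`) extension
operator `C(K) → C(Y)`. Restricting `Y` to the universe of `K` is harmless: it is enough to
consider one embedding of `K` in a Tychonoff cube `[0,1]^C(K)`. -/
def IsDugundji (K : Type u) [TopologicalSpace K] : Prop :=
  CompactSpace K ∧ T2Space K ∧
  ∀ (Y : Type u) [TopologicalSpace Y] [CompactSpace Y] [T2Space Y] (i : K → Y),
    Topology.IsEmbedding i →
    ∃ E : C(K, ℝ) →ₗ[ℝ] C(Y, ℝ),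
      E 1 = 1 ∧ (∀ f, 0 ≤ f → 0 ≤ E f) ∧ ∀ f k, E f (i k) = f k

/-- A continuous map `p : X → Y` has a metrizable kernel if there are a separable metrizable space
`M` and an embedding of `X` in `Y × M` under which `p` is the restriction of the projection
`Y × M → Y`. -/
def HasMetrizableKernel {X Y : Type u} [TopologicalSpace X] [TopologicalSpace Y]
    (p : X → Y) : Prop :=
  ∃ (M : Type u) (_ : TopologicalSpace M), TopologicalSpace.SeparableSpace M ∧
    TopologicalSpace.MetrizableSpace M ∧
    ∃ e : X → Y × M, Topology.IsEmbedding e ∧ ∀ x, (e x).1 = p x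

/-- An inverse system of Tychonoff spaces `obj α`, `α < τ`, with continuous surjective bonding
maps `map : obj β → obj α`, `α ≤ β < τ`. -/
structure WellOrderedInverseSystem (τ : Ordinal.{u}) where
  obj : Set.Iio τ → Type u
  [top : ∀ α, TopologicalSpace (obj α)]
  tychonoff : ∀ α, T35Space (obj α)
  map : ∀ {α β : Set.Iio τ}, α ≤ β → obj β → obj α
  continuous_map : ∀ {α β : Set.Iio τ} (h : α ≤ β), Continuous (map h)
  surjective_map : ∀ {α β : Set.Iio τ} (h : α ≤ β), Function.Surjective (map h)
  map_self : ∀ (α : Set.Iio τ) (x : obj α), map le_rfl x = x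
  map_map : ∀ {α β γ : Set.Iio τ} (h : α ≤ β) (h' : β ≤ γ) (x : obj γ),
    map h (map h' x) = map (h.trans h') x

attribute [instance] WellOrderedInverseSystem.top

namespace WellOrderedInverseSystem

variable {τ : Ordinal.{u}}

/-- The inverse limit of the part of the system indexed by `s`: the space of threads, as a
subspace of the product. -/
def Lim (S : WellOrderedInverseSystem τ) (s : Set (Set.Iio τ)) : Type (u + 1) :=
  {x : ∀ α : s, S.obj α.1 // ∀ (α β : s) (h : α.1 ≤ β.1), S.map h (x β) = x α}

instance (S : WellOrderedInverseSystem τ) (s : Set (Set.Iio τ)) : TopologicalSpace (S.Lim s) :=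
  inferInstanceAs (TopologicalSpace
    {x : ∀ α : s, S.obj α.1 // ∀ (α β : s) (h : α.1 ≤ β.1), S.map h (x β) = x α})

/-- The limit of the whole system. -/
abbrev FullLim (S : WellOrderedInverseSystem τ) : Type (u + 1) := S.Lim Set.univ

/-- The limit projection `p_α`. -/
def proj (S : WellOrderedInverseSystem τ) (α : Set.Iio τ) (x : S.FullLim) : S.obj α :=
  x.1 ⟨α, Set.mem_univ α⟩

/-- The canonical map from `obj γ` to the limit of the spaces `obj α`, `α < γ`. -/
def toLimBelow (S : WellOrderedInverseSystem τ) (γ : Set.Iio τ) (x : S.obj γ) :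
    S.Lim (Set.Iio γ) :=
  ⟨fun α => S.map (le_of_lt α.2) x, fun _ β h => S.map_map h (le_of_lt β.2) x⟩

/-- The system is almost continuous: for every limit ordinal `γ < τ`, the space `obj γ` is a dense
subspace of the limit of the spaces `obj α`, `α < γ`. -/
def AlmostContinuous (S : WellOrderedInverseSystem τ) : Prop :=
  ∀ γ : Set.Iio τ, Order.IsSuccLimit γ.1 →
    Topology.IsEmbedding (S.toLimBelow γ) ∧ DenseRange (S.toLimBelow γ)

/-- `X` is the almost limit of the system: it embeds in the limit so that it is mapped onto every
`obj α` by the limit projection. -/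
def IsAlmostLimit (S : WellOrderedInverseSystem τ) (X : Type u) [TopologicalSpace X] : Prop :=
  ∃ e : X → S.FullLim, Topology.IsEmbedding e ∧ ∀ α, Function.Surjective fun x => S.proj α (e x)

/-- The system is factorizing: every bounded continuous real-valued function on the limit factors
through some limit projection. -/
def Factorizing (S : WellOrderedInverseSystem τ) : Prop :=
  ∀ f : S.FullLim → ℝ, Continuous f → (∃ C : ℝ, ∀ x, |f x| ≤ C) →
    ∃ (α : Set.Iio τ) (g : S.obj α → ℝ), Continuous g ∧ ∀ x, f x = g (S.proj α x)

end WellOrderedInverseSystem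

/-- A Tychonoff space `X` is openly Dugundji if it is the almost limit of an almost continuous
factorizing well-ordered inverse system, indexed by the ordinals below a nonzero cardinal, with
open surjective bonding maps, such that `X_0` is separable metrizable and the maps
`X_{α+1} → X_α` have metrizable kernels. -/
def IsOpenlyDugundji (X : Type u) [TopologicalSpace X] : Prop :=
  T35Space X ∧ ∃ τ : Cardinal.{u}, τ ≠ 0 ∧ ∃ S : WellOrderedInverseSystem τ.ord,
    (∀ (α β : Set.Iio τ.ord) (h : α ≤ β), IsOpenMap (S.map h)) ∧
    (∀ α : Set.Iio τ.ord, α.1 = 0 →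
      TopologicalSpace.SeparableSpace (S.obj α) ∧
        TopologicalSpace.MetrizableSpace (S.obj α)) ∧
    (∀ (α β : Set.Iio τ.ord) (h : α ≤ β), β.1 = Order.succ α.1 → HasMetrizableKernel (S.map h)) ∧
    S.AlmostContinuous ∧ S.IsAlmostLimit X ∧ S.Factorizing

/-! Everything rests on one Baire category argument: if an ω-narrow group acts transitively by
homeomorphisms on a Baire space, the closure of `U • y` is a neighbourhood of `y` for every
neighbourhood `U` of `1` (`closure_orbit_mem_nhds`). Pseudocompact and Čech-complete spaces are
Baire. Near openness of the orbit maps upgrades separate continuity to joint continuity, and it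
makes closed equivariant maps onto transitive Baire spaces open.

For (a), the relations `y ∈ closure (U • x)` generate a totally bounded uniformity on `X`. Its
completion `K` is a compact `G`-space in which `X` is a `Gδ`-dense orbit. The quotient of `K` by the
translates of countably many functions is metrizable and transitive, so the quotient map is open;
comparing suprema over classes carries openness over to arbitrary sets of functions
(`IsAlmostTransitive.isOpenMap_mk`). Adjoining one function enlarges a quotient by a metrizable
factor only, and across such a step a regular extension operator is prolonged by integrating against
a continuous family of probability measures (`exists_fiberwise_integral`). Zorn's lemma then reaches
all of `C(K)`, so `K` is Dugundji. Hence `K` has the countable chain condition, closures of open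
sets depend on countably many functions, and disjointness of closures can be tested on `X`; this
gives `K = βX` (`IsAlmostTransitive.exists_extension`).

For (b), `X` is locally compact, and a positive `f₀` vanishing at infinity makes every quotient by a
set of functions containing `f₀` proper. As `X` itself is transitive, all these quotient maps are
open. Adjoining the functions vanishing at infinity along a well-order yields the inverse system,
which has become `X` by stage `topRank X`. -/

open Set Filter Topology Uniformity

/-! ### Near openness of orbit maps and its consequences -/

section Action

variable {G : Type v} [Group G] [TopologicalSpace G]

theorem IsOmegaNarrow.exists_left (hG : IsOmegaNarrow G) {U : Set G} (hU : U ∈ 𝓝 (1 : G)) :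
    ∃ A : Set G, A.Countable ∧ ∀ g : G, ∃ a ∈ A, ∃ x ∈ U, a * x = g := by
  obtain ⟨A, hA, -, h⟩ := hG U hU
  exact ⟨A, hA, h⟩

theorem IsOmegaNarrow.exists_right (hG : IsOmegaNarrow G) {U : Set G} (hU : U ∈ 𝓝 (1 : G)) :
    ∃ A : Set G, A.Countable ∧ ∀ g : G, ∃ x ∈ U, ∃ a ∈ A, x * a = g := by
  obtain ⟨A, hA, h, -⟩ := hG U hU
  exact ⟨A, hA, h⟩

theorem exists_nhds_one_inv_mul_subset [IsTopologicalGroup G] {U : Set G} (hU : U ∈ 𝓝 (1 : G)) :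
    ∃ V ∈ 𝓝 (1 : G), ∀ v ∈ V, ∀ w ∈ V, v⁻¹ * w ∈ U := by
  have h : Tendsto (fun p : G × G => p.1⁻¹ * p.2) (𝓝 (1, 1)) (𝓝 1) := by
    have : Continuous fun p : G × G => p.1⁻¹ * p.2 := by fun_prop
    simpa using this.tendsto ((1 : G), (1 : G))
  have := h hU
  rw [nhds_prod_eq, mem_map, mem_prod_same_iff] at this
  obtain ⟨V, hV, h⟩ := this
  exact ⟨V, hV, fun v hv w hw => h (mk_mem_prod hv hw)⟩

/-- In a Baire space, orbit maps of a transitive action of an `ω`-narrow group by homeomorphisms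
are nearly open. -/
theorem closure_orbit_mem_nhds [IsTopologicalGroup G] (hG : IsOmegaNarrow G)
    {Y : Type*} [TopologicalSpace Y] [BaireSpace Y] [MulAction G Y] [ContinuousConstSMul G Y]
    [MulAction.IsPretransitive G Y] {U : Set G} (hU : U ∈ 𝓝 (1 : G)) (y : Y) :
    closure ((fun g : G => g • y) '' U) ∈ 𝓝 y := by
  obtain ⟨V, hV, hVU⟩ := exists_nhds_one_inv_mul_subset hU
  obtain ⟨A, hA, hAV⟩ := hG.exists_left hV
  set S : Set Y := (fun g : G => g • y) '' V with hS
  have : Countable A := hA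
  have : Nonempty Y := ⟨y⟩
  -- Since `G = A * V`, countably many closed sets `a • closure S` cover `Y`; one of them has
  -- interior points.
  obtain ⟨a, ha⟩ := nonempty_interior_of_iUnion_of_closed
    (f := fun a : A => (fun z : Y => (a : G) • z) '' closure S)
    (fun a => (isClosedMap_smul (a : G)) _ isClosed_closure) (by
      refine eq_univ_of_forall fun z => ?_
      obtain ⟨g, rfl⟩ := MulAction.exists_smul_eq G y z
      obtain ⟨a, ha, v, hv, rfl⟩ := hAV g
      refine mem_iUnion.2 ⟨⟨a, ha⟩, v • y, subset_closure ⟨v, hv, rfl⟩, ?_⟩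
      simp [mul_smul])
  have h1 : (interior (closure S)).Nonempty := by
    have := (Homeomorph.smul (a : G)).image_interior (closure S)
    have h2 : (fun z : Y => (a : G) • z) '' interior (closure S)
      = interior ((fun z : Y => (a : G) • z) '' closure S) := this
    rw [← h2] at ha
    exact ha.of_image
  obtain ⟨z, hz⟩ := h1
  -- The interior of `closure S` contains some `v • y` with `v ∈ V`; translating by `v⁻¹` moves it
  -- to `y`, and `v⁻¹ * V ⊆ U`.
  obtain ⟨w, hw, ⟨v, hv, rfl⟩⟩ :=
    mem_closure_iff.1 (interior_subset hz) _ isOpen_interior hz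
  have h3 : (fun z : Y => v • z) ⁻¹' (closure S) ∈ 𝓝 y :=
    (continuous_const_smul v).continuousAt.preimage_mem_nhds (mem_interior_iff_mem_nhds.1 hw)
  filter_upwards [h3] with x hx
  have h4 : v⁻¹ • (v • x) ∈ closure ((fun z : Y => v⁻¹ • z) '' S) :=
    image_closure_subset_closure_image (continuous_const_smul v⁻¹) ⟨_, hx, rfl⟩
  rw [inv_smul_smul] at h4
  refine closure_mono ?_ h4
  rintro _ ⟨_, ⟨w, hw, rfl⟩, rfl⟩
  exact ⟨v⁻¹ * w, hVU v hv w hw, by simp [mul_smul]⟩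

/-- A separately continuous action with nearly open orbit maps is jointly continuous. -/
theorem continuous_smul_of_closure_orbit_mem_nhds [IsTopologicalGroup G]
    {X : Type*} [TopologicalSpace X] [RegularSpace X] [MulAction G X]
    (hc : ∀ g : G, Continuous fun x : X => g • x)
    (ho : ∀ x : X, Continuous fun g : G => g • x)
    (hn : ∀ U ∈ 𝓝 (1 : G), ∀ x : X, closure ((fun g : G => g • x) '' U) ∈ 𝓝 x) :
    Continuous fun p : G × X => p.1 • p.2 := by
  have key : ∀ x : X, Tendsto (fun p : G × X => p.1 • p.2) (𝓝 1 ×ˢ 𝓝 x) (𝓝 x) := by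
    intro x W hW
    obtain ⟨C, hC, hCc, hCW⟩ := exists_mem_nhds_isClosed_subset hW
    have h1 : (fun g : G => g • x) ⁻¹' C ∈ 𝓝 (1 : G) :=
      (ho x).continuousAt.preimage_mem_nhds (by simpa using hC)
    have h2 : Tendsto (fun p : G × G => p.1 * p.2) (𝓝 1 ×ˢ 𝓝 1) (𝓝 1) := by
      have : Continuous fun p : G × G => p.1 * p.2 := by fun_prop
      simpa [nhds_prod_eq] using this.tendsto ((1 : G), (1 : G))
    obtain ⟨U, hU, hUC⟩ := mem_prod_same_iff.1 (h2 h1)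
    rw [mem_map, mem_prod_iff]
    refine ⟨U, hU, _, hn U hU x, ?_⟩
    rintro ⟨u, z⟩ ⟨hu, hz⟩
    apply hCW
    -- Continuity of the single translation by `u` gives `u • closure (U • x) ⊆ closure (U * U • x)
    -- ⊆ C`.
    have h3 : u • z ∈ closure ((fun z : X => u • z) '' ((fun g : G => g • x) '' U)) :=
      image_closure_subset_closure_image (hc u) ⟨_, hz, rfl⟩
    refine closure_minimal ?_ hCc h3
    rintro _ ⟨_, ⟨w, hw, rfl⟩, rfl⟩
    have := hUC (mk_mem_prod hu hw)
    simpa [mul_smul] using this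
  rw [continuous_iff_continuousAt]
  rintro ⟨g, x⟩
  have h1 : Tendsto (fun p : G × X => ((g⁻¹ * p.1, p.2) : G × X)) (𝓝 (g, x)) (𝓝 1 ×ˢ 𝓝 x) := by
    have : Continuous fun p : G × X => ((g⁻¹ * p.1, p.2) : G × X) := by fun_prop
    simpa [nhds_prod_eq] using this.tendsto (g, x)
  have h2 := ((hc g).tendsto x).comp ((key x).comp h1)
  refine h2.congr fun p => ?_
  simp [mul_smul]

/-- A closed continuous equivariant map onto a Baire space on which an `ω`-narrow group acts
transitively is open. -/
theorem isOpenMap_of_isClosedMap_of_equivariant [IsTopologicalGroup G] (hG : IsOmegaNarrow G)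
    {X Y : Type*} [TopologicalSpace X] [RegularSpace X] [MulAction G X]
    (ho : ∀ x : X, ContinuousAt (fun g : G => g • x) 1)
    [TopologicalSpace Y] [BaireSpace Y] [MulAction G Y] [ContinuousConstSMul G Y]
    [MulAction.IsPretransitive G Y] {p : X → Y} (hpc : IsClosedMap p)
    (hp : ∀ (g : G) x, p (g • x) = g • p x) : IsOpenMap p := by
  rw [isOpenMap_iff_nhds_le]
  intro x W hW
  obtain ⟨C, hC, hCc, hCW⟩ := exists_mem_nhds_isClosed_subset (mem_map.1 hW)
  have h1 : (fun g : G => g • x) ⁻¹' C ∈ 𝓝 (1 : G) :=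
    (ho x).preimage_mem_nhds (by simpa using hC)
  have h2 := closure_orbit_mem_nhds hG h1 (p x)
  refine mem_of_superset h2 (?_ : _ ⊆ W)
  -- The closed set `p '' C` contains a piece of the orbit of `p x` whose closure is a neighbourhood
  -- of `p x`.
  refine (closure_minimal ?_ (hpc C hCc)).trans (image_subset_iff.2 hCW)
  rintro _ ⟨g, hg, rfl⟩
  exact ⟨g • x, hg, hp g x⟩

/-- A real function `f` on a `G`-space is orbit uniform if `f (u • x)` is uniformly close to `f x`
for `u` close to `1`. -/
def IsOrbitUniform (G : Type v) [Group G] [TopologicalSpace G] {X : Type*} [MulAction G X]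
    (f : X → ℝ) : Prop :=
  ∀ ε > 0, ∃ U ∈ 𝓝 (1 : G), ∀ u ∈ U, ∀ x, |f (u • x) - f x| ≤ ε

/-- The translates of an orbit uniform function under an `ω`-narrow group form a separable set. -/
theorem IsOrbitUniform.exists_countable (hG : IsOmegaNarrow G) {X : Type*} [MulAction G X]
    {f : X → ℝ} (hf : IsOrbitUniform G f) :
    ∃ D : Set G, D.Countable ∧ ∀ ε > 0, ∀ g : G, ∃ d ∈ D, ∀ x, |f (g • x) - f (d • x)| ≤ ε := by
  choose! U hU hUf using hf
  choose! A hA hUA using fun V (hV : V ∈ 𝓝 (1 : G)) => hG.exists_right hV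
  refine ⟨⋃ n : ℕ, A (U (1 / (n + 1))), countable_iUnion fun n => hA _ (hU _ (by positivity)), ?_⟩
  intro ε hε g
  obtain ⟨n, hn⟩ := exists_nat_one_div_lt hε
  -- The small factor `u` must stand on the left: then `f (u • (a • x))` is close to `f (a • x)`
  -- uniformly in `x`.
  obtain ⟨u, hu, a, ha, rfl⟩ := hUA (U (1 / (n + 1))) (hU _ (by positivity)) g
  refine ⟨a, mem_iUnion.2 ⟨n, ha⟩, fun x => ?_⟩
  rw [mul_smul]
  exact (hUf _ (by positivity) u hu (a • x)).trans hn.le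

end Action

/-! ### Invariant quotients determined by sets of functions -/

section Quotient

variable {G : Type v} [Group G] {X : Type u} [TopologicalSpace X] [MulAction G X]

variable (G) in
/-- Two points are related if the functions in `F` do not distinguish any of their translates. -/
def translateSetoid (F : Set C(X, ℝ)) : Setoid X where
  r x y := ∀ f ∈ F, ∀ g : G, f (g • x) = f (g • y)
  iseqv := ⟨fun _ _ _ _ => rfl, fun h f hf g => (h f hf g).symm,
    fun h h' f hf g => (h f hf g).trans (h' f hf g)⟩

variable (G) in
/-- The quotient of a `G`-space by the largest invariant relation respecting the functions
in `F`. -/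
def TranslateQuotient (F : Set C(X, ℝ)) : Type u := Quotient (translateSetoid G F)

namespace TranslateQuotient

variable {F F' : Set C(X, ℝ)}

instance : TopologicalSpace (TranslateQuotient G F) :=
  inferInstanceAs (TopologicalSpace (Quotient (translateSetoid G F)))

variable (G F) in
/-- The quotient map. -/
def mk (x : X) : TranslateQuotient G F := Quotient.mk (translateSetoid G F) x

theorem mk_eq_mk {x y : X} : mk G F x = mk G F y ↔ ∀ f ∈ F, ∀ g : G, f (g • x) = f (g • y) :=
  Quotient.eq (r := translateSetoid G F)

theorem isQuotientMap_mk : IsQuotientMap (mk G F) := isQuotientMap_quot_mk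

theorem continuous_mk : Continuous (mk G F) := isQuotientMap_mk.continuous

theorem surjective_mk : Function.Surjective (mk G F) := isQuotientMap_mk.surjective

instance : MulAction G (TranslateQuotient G F) where
  smul g := Quotient.map' (s₁ := translateSetoid G F) (s₂ := translateSetoid G F) (fun x => g • x)
    fun x y h f hf k => by simpa [mul_smul] using h f hf (k * g)
  one_smul := by
    refine surjective_mk.forall.2 fun x => ?_
    change mk G F ((1 : G) • x) = mk G F x
    rw [one_smul]
  mul_smul a b := by
    refine surjective_mk.forall.2 fun x => ?_
    change mk G F ((a * b) • x) = mk G F (a • b • x)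
    rw [mul_smul]

theorem mk_smul (g : G) (x : X) : mk G F (g • x) = g • mk G F x := rfl

instance [ContinuousConstSMul G X] : ContinuousConstSMul G (TranslateQuotient G F) where
  continuous_const_smul g := isQuotientMap_mk.continuous_iff.2
    (continuous_mk.comp (continuous_const_smul g) : Continuous fun x => mk G F (g • x))

instance [MulAction.IsPretransitive G X] :
    MulAction.IsPretransitive G (TranslateQuotient G F) where
  exists_smul_eq := by
    refine surjective_mk.forall₂.2 fun x y => ?_
    obtain ⟨g, rfl⟩ := MulAction.exists_smul_eq G x y
    exact ⟨g, rfl⟩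

instance [CompactSpace X] : CompactSpace (TranslateQuotient G F) :=
  inferInstanceAs (CompactSpace (Quotient (translateSetoid G F)))

/-- The function induced on the quotient by a translate of a function in `F`. -/
def lift [ContinuousConstSMul G X] (f : C(X, ℝ)) (hf : f ∈ F) (g : G) :
    C(TranslateQuotient G F, ℝ) where
  toFun := Quotient.lift (s := translateSetoid G F) (fun x => f (g • x)) fun _ _ h => h f hf g
  continuous_toFun := isQuotientMap_mk.continuous_iff.2
    (f.continuous.comp (continuous_const_smul g) : Continuous fun x => f (g • x))

@[simp]
theorem lift_mk [ContinuousConstSMul G X] (f : C(X, ℝ)) (hf : f ∈ F) (g : G) (x : X) :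
    lift f hf g (mk G F x) = f (g • x) := rfl

/-- The translates of the functions in `F` descend to continuous functions that separate classes. -/
instance [ContinuousConstSMul G X] : T2Space (TranslateQuotient G F) := by
  refine .of_injective_continuous
    (f := fun (z : TranslateQuotient G F) (i : F × G) => lift i.1.1 i.1.2 i.2 z) ?_ (by fun_prop)
  refine surjective_mk.forall₂.2 fun x y h => mk_eq_mk.2 fun f hf g => ?_
  exact congr_fun h (⟨f, hf⟩, g)

/-- The canonical map between quotients. -/
def map (h : F ⊆ F') : TranslateQuotient G F' → TranslateQuotient G F :=
  Quotient.map' (s₁ := translateSetoid G F') (s₂ := translateSetoid G F) id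
    fun _ _ hxy f hf => hxy f (h hf)

theorem continuous_map (h : F ⊆ F') : Continuous (map (G := G) h) :=
  isQuotientMap_mk.continuous_iff.2 (continuous_mk : Continuous (mk G F))

theorem surjective_map (h : F ⊆ F') : Function.Surjective (map (G := G) h) := by
  refine surjective_mk.forall.2 fun x => ⟨mk G F' x, rfl⟩

theorem isOpenMap_map (h : F ⊆ F') (ho : IsOpenMap (mk G F)) : IsOpenMap (map (G := G) h) :=
  fun O hO => by
    have h1 : map h '' O = mk G F '' (mk G F' ⁻¹' O) := by
      ext z
      constructor
      · rintro ⟨w, hw, rfl⟩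
        obtain ⟨x, rfl⟩ := surjective_mk w
        exact ⟨x, hw, rfl⟩
      · rintro ⟨x, hx, rfl⟩
        exact ⟨mk G F' x, hx, rfl⟩
    rw [h1]
    exact ho _ (hO.preimage continuous_mk)

/-- For countably many orbit uniform functions, countably many translates determine the
quotient. -/
theorem exists_countable_mk_eq_mk_iff [TopologicalSpace G] (hG : IsOmegaNarrow G)
    (hFc : F.Countable) (hF : ∀ f ∈ F, IsOrbitUniform G f) :
    ∃ S : Set (F × G), S.Countable ∧
      ∀ x y, (∀ s ∈ S, s.1.1 (s.2 • x) = s.1.1 (s.2 • y)) → mk G F x = mk G F y := by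
  choose D hD hDd using fun f : F => (hF f.1 f.2).exists_countable hG
  have : Countable F := hFc
  refine ⟨⋃ f : F, Prod.mk f '' D f, countable_iUnion fun f => (hD f).image _, fun x y h => ?_⟩
  refine mk_eq_mk.2 fun f hf g => ?_
  refine eq_of_forall_dist_le fun ε hε => ?_
  obtain ⟨d, hd, hdg⟩ := hDd ⟨f, hf⟩ (ε / 2) (by positivity) g
  have h1 := h (⟨f, hf⟩, d) (mem_iUnion.2 ⟨⟨f, hf⟩, d, hd, rfl⟩)
  have h2 := abs_le.1 (hdg x)
  have h3 := abs_le.1 (hdg y)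
  simp only at h1 h2 h3
  rw [Real.dist_eq, abs_le]
  constructor <;> linarith

end TranslateQuotient

end Quotient

/-! ### Almost transitive compact spaces -/

section Compact

variable (G : Type v) [Group G] [TopologicalSpace G] {K : Type u} [TopologicalSpace K]
  [MulAction G K]

/-- A `G`-space whose continuous functions are orbit uniform, with a `Gδ`-dense orbit: countably
many continuous functions do not distinguish it from the whole space. -/
structure IsAlmostTransitive (x₀ : K) : Prop where
  orbitUniform : ∀ f : C(K, ℝ), IsOrbitUniform G f
  exists_smul : ∀ S : Set C(K, ℝ), S.Countable → ∀ z, ∃ g : G, ∀ f ∈ S, f (g • x₀) = f z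

namespace IsAlmostTransitive

variable {G} {x₀ : K}

theorem continuousAt_smul [CompactSpace K] [T2Space K] (h : IsAlmostTransitive G x₀) (x : K) :
    ContinuousAt (fun g : G => g • x) 1 := by
  intro W hW
  simp only [one_smul] at hW
  obtain ⟨O, hOW, hO, hxO⟩ := mem_nhds_iff.1 hW
  obtain ⟨f, hf0, hf1, -⟩ := exists_continuous_zero_one_of_isClosed
    (isClosed_singleton (x := x)) hO.isClosed_compl (by simpa using hxO)
  obtain ⟨U, hU, hUf⟩ := h.orbitUniform f (1 / 2) (by norm_num)
  rw [mem_map]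
  filter_upwards [hU] with u hu
  refine hOW (by_contra fun hux => ?_)
  have h1 := hUf u hu x
  rw [hf0 rfl, hf1 hux] at h1
  norm_num at h1

theorem dense_orbit [CompactSpace K] [T2Space K] (h : IsAlmostTransitive G x₀) : Dense (MulAction.orbit G x₀) := by
  intro z
  rw [mem_closure_iff]
  intro O hO hz
  obtain ⟨f, hf0, hf1, -⟩ := exists_continuous_zero_one_of_isClosed
    (isClosed_singleton (x := z)) hO.isClosed_compl (by simpa using hz)
  obtain ⟨g, hg⟩ := h.exists_smul {f} (countable_singleton f) z
  refine ⟨g • x₀, by_contra fun hux => ?_, ⟨g, rfl⟩⟩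
  have h1 := hg f rfl
  rw [hf0 rfl, hf1 hux] at h1
  norm_num at h1

variable [ContinuousConstSMul G K]

/-- Countably many translates decide equality in the quotient, and `Gδ`-density of the orbit
provides a `g • x₀` matching any given point on all of them. So the orbit of `x₀` meets every class.
-/
theorem isPretransitive_of_countable (hG : IsOmegaNarrow G) (h : IsAlmostTransitive G x₀)
    {F : Set C(K, ℝ)} (hF : F.Countable) :
    MulAction.IsPretransitive G (TranslateQuotient G F) := by
  obtain ⟨S, hS, hSF⟩ := TranslateQuotient.exists_countable_mk_eq_mk_iff hG hF
    fun f _ => h.orbitUniform f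
  refine (MulAction.isPretransitive_iff_base (TranslateQuotient.mk G F x₀)).2 ?_
  refine TranslateQuotient.surjective_mk.forall.2 fun z => ?_
  obtain ⟨g, hg⟩ := h.exists_smul
    ((fun s : F × G => s.1.1.comp ⟨fun x : K => s.2 • x, continuous_const_smul s.2⟩) '' S)
    (hS.image _) z
  exact ⟨g, hSF _ _ fun s hs => hg _ ⟨s, hs, rfl⟩⟩

/-- The quotient is compact Hausdorff, hence Baire, and transitive; the quotient map is closed by
compactness, so near openness of orbits applies. -/
theorem isOpenMap_mk_of_countable [CompactSpace K] [T2Space K] [IsTopologicalGroup G]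
    (hG : IsOmegaNarrow G) (h : IsAlmostTransitive G x₀) {F : Set C(K, ℝ)} (hF : F.Countable) :
    IsOpenMap (TranslateQuotient.mk G F) := by
  have := h.isPretransitive_of_countable hG hF
  exact isOpenMap_of_isClosedMap_of_equivariant hG h.continuousAt_smul
    TranslateQuotient.continuous_mk.isClosedMap fun _ _ => rfl

end IsAlmostTransitive

end Compact

/-! ### Openness of arbitrary invariant quotient maps -/

section FiberSup

variable {G : Type v} [Group G] {K : Type u} [TopologicalSpace K] [CompactSpace K]
  [MulAction G K]

variable (G) in
/-- The supremum of `f` over the class of a point in `TranslateQuotient G F`. -/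
noncomputable def fiberSup (F : Set C(K, ℝ)) (f : C(K, ℝ)) (x : K) : ℝ :=
  sSup (f '' {z | TranslateQuotient.mk G F z = TranslateQuotient.mk G F x})

variable {F F' : Set C(K, ℝ)} {f : C(K, ℝ)} {x : K}

theorem fiberSup_le_iff {c : ℝ} : fiberSup G F f x ≤ c ↔
    ∀ z, TranslateQuotient.mk G F z = TranslateQuotient.mk G F x → f z ≤ c := by
  have hb : BddAbove (f '' {z | TranslateQuotient.mk G F z = TranslateQuotient.mk G F x}) :=
    (isCompact_range f.continuous).bddAbove.mono (image_subset_range _ _)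
  rw [fiberSup, csSup_le_iff hb (Nonempty.image _ ⟨x, rfl⟩)]
  simp

theorem lt_fiberSup_iff {c : ℝ} : c < fiberSup G F f x ↔
    ∃ z, TranslateQuotient.mk G F z = TranslateQuotient.mk G F x ∧ c < f z := by
  rw [← not_le, fiberSup_le_iff]
  push Not
  rfl

theorem le_fiberSup {z : K} (hz : TranslateQuotient.mk G F z = TranslateQuotient.mk G F x) :
    f z ≤ fiberSup G F f x :=
  fiberSup_le_iff.1 le_rfl z hz

theorem fiberSup_anti (h : F ⊆ F') : fiberSup G F' f x ≤ fiberSup G F f x :=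
  fiberSup_le_iff.2 fun _ hz => le_fiberSup (congr_arg (TranslateQuotient.map h) hz)

theorem fiberSup_le_add {f' : C(K, ℝ)} {ε : ℝ} (h : ∀ z, f z ≤ f' z + ε) :
    fiberSup G F f x ≤ fiberSup G F f' x + ε :=
  fiberSup_le_iff.2 fun z hz => (h z).trans (add_le_add_left (le_fiberSup hz) ε)

variable [ContinuousConstSMul G K]

theorem fiberSup_smul (g : G) :
    fiberSup G F f (g • x) = fiberSup G F (f.comp ⟨fun x => g • x, continuous_const_smul g⟩) x := by
  refine eq_of_forall_ge_iff fun c => ?_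
  rw [fiberSup_le_iff, fiberSup_le_iff]
  refine ((MulAction.surjective g).forall).trans (forall_congr' fun z => ?_)
  simp [TranslateQuotient.mk_smul]

theorem fiberSup_lt_iff [T2Space K] {c : ℝ} : fiberSup G F f x < c ↔
    ∀ z, TranslateQuotient.mk G F z = TranslateQuotient.mk G F x → f z < c := by
  refine ⟨fun h z hz => (le_fiberSup hz).trans_lt h, fun h => ?_⟩
  have hcl : IsClosed {z | TranslateQuotient.mk G F z = TranslateQuotient.mk G F x} :=
    isClosed_eq TranslateQuotient.continuous_mk continuous_const
  obtain ⟨z, hz, hmax⟩ := hcl.isCompact.exists_isMaxOn ⟨x, rfl⟩ f.continuous.continuousOn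
  exact (fiberSup_le_iff.2 hmax).trans_lt (h z hz)

/-- Openness of the quotient map gives lower semicontinuity; its closedness, automatic by
compactness, gives upper semicontinuity. -/
theorem continuous_fiberSup [T2Space K] (ho : IsOpenMap (TranslateQuotient.mk G F)) :
    Continuous (fiberSup G F f) := by
  have hc : IsClosedMap (TranslateQuotient.mk G F) :=
    TranslateQuotient.continuous_mk.isClosedMap
  refine OrderTopology.continuous_iff.2 fun c => ⟨?_, ?_⟩
  · convert (ho _ (isOpen_Ioi.preimage f.continuous : IsOpen (f ⁻¹' Ioi c))).preimage
      TranslateQuotient.continuous_mk using 1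
    ext x
    simp only [mem_preimage, mem_Ioi, lt_fiberSup_iff, mem_image]
    exact ⟨fun ⟨z, h, h'⟩ => ⟨z, h', h⟩, fun ⟨z, h, h'⟩ => ⟨z, h', h⟩⟩
  · rw [← isClosed_compl_iff]
    convert (hc _ (isClosed_Ici.preimage f.continuous : IsClosed (f ⁻¹' Ici c))).preimage
      TranslateQuotient.continuous_mk using 1
    ext x
    simp only [mem_compl_iff, mem_preimage, mem_Iio, fiberSup_lt_iff, mem_image, mem_Ici]
    push Not
    exact ⟨fun ⟨z, h, h'⟩ => ⟨z, h', h⟩, fun ⟨z, h, h'⟩ => ⟨z, h', h⟩⟩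

/-- By compactness, finitely many of the conditions defining the class of `x` already keep `f` below
the supremum plus `1 / (n + 1)`. Collect the functions involved over all `n`. -/
theorem exists_countable_fiberSup_eq [T2Space K] (F : Set C(K, ℝ)) (f : C(K, ℝ)) (x : K) :
    ∃ C ⊆ F, C.Countable ∧ fiberSup G C f x = fiberSup G F f x := by
  have key : ∀ n : ℕ, ∃ C ⊆ F, C.Finite ∧ fiberSup G C f x ≤ fiberSup G F f x + 1 / (n + 1) := by
    intro n
    have hpos : (0 : ℝ) < 1 / (n + 1) := by positivity
    obtain ⟨t, ht⟩ := (isClosed_Ici.preimage f.continuous :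
        IsClosed (f ⁻¹' Ici (fiberSup G F f x + 1 / (n + 1)))).isCompact.elim_finite_subfamily_closed
      (fun i : F × G => {z | i.1.1 (i.2 • z) = i.1.1 (i.2 • x)})
      (fun i => isClosed_eq (i.1.1.continuous.comp (continuous_const_smul i.2)) continuous_const)
      (by
        refine eq_empty_of_forall_notMem fun z ⟨hz, hz'⟩ => ?_
        rw [mem_iInter] at hz'
        have := le_fiberSup (f := f)
          (TranslateQuotient.mk_eq_mk.2 fun φ hφ g => hz' (⟨φ, hφ⟩, g))
        have h2 : _ ≤ f z := hz
        linarith)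
    refine ⟨(fun i : F × G => i.1.1) '' t, ?_, t.finite_toSet.image _, ?_⟩
    · rintro _ ⟨i, -, rfl⟩
      exact i.1.2
    · refine fiberSup_le_iff.2 fun z hz => le_of_not_ge fun hlt => ?_
      refine eq_empty_iff_forall_notMem.1 ht z ⟨hlt, mem_iInter₂.2 fun i hi => ?_⟩
      exact TranslateQuotient.mk_eq_mk.1 hz _ ⟨i, hi, rfl⟩ i.2
  choose C hCF hC hCf using key
  have hsub : ⋃ n, C n ⊆ F := iUnion_subset hCF
  refine ⟨⋃ n, C n, hsub, countable_iUnion fun n => (hC n).countable,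
    le_antisymm ?_ (fiberSup_anti hsub)⟩
  refine le_of_forall_pos_le_add fun ε hε => ?_
  obtain ⟨n, hn⟩ := exists_nat_one_div_lt hε
  have h1 : fiberSup G (⋃ n, C n) f x ≤ fiberSup G (C n) f x :=
    fiberSup_anti (subset_iUnion C n)
  have h2 := hCf n
  linarith

variable [TopologicalSpace G]

/-- All quotient maps of an almost transitive compact space by invariant relations given by
functions are open. -/
theorem IsAlmostTransitive.isOpenMap_mk [T2Space K] [IsTopologicalGroup G]
    (hG : IsOmegaNarrow G) {x₀ : K} (h : IsAlmostTransitive G x₀) (F : Set C(K, ℝ)) :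
    IsOpenMap (TranslateQuotient.mk G F) := by
  have key : ∀ f : C(K, ℝ), Continuous (fiberSup G F f) := by
    intro f
    let tr : G → C(K, ℝ) := fun g => f.comp ⟨fun x => g • x, continuous_const_smul g⟩
    obtain ⟨D, hD, hDf⟩ := (h.orbitUniform f).exists_countable hG
    choose C hCF hC hCeq using fun d : G => exists_countable_fiberSup_eq (G := G) F (tr d) x₀
    have hUF : ⋃ d ∈ D, C d ⊆ F := iUnion₂_subset fun d _ => hCF d
    have hUc : (⋃ d ∈ D, C d).Countable := hD.biUnion fun d _ => hC d
    -- A countable part of `F` that computes the supremum at every point of the orbit, since the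
    -- translates by `D` approximate all translates of `f`.
    set C₀ := ⋃ d ∈ D, C d with hC₀
    have h1 : ∀ g : G, fiberSup G C₀ f (g • x₀) ≤ fiberSup G F f (g • x₀) := by
      intro g
      refine le_of_forall_pos_le_add fun ε hε => ?_
      obtain ⟨d, hd, hdg⟩ := hDf (ε / 2) (by positivity) g
      have h2 : fiberSup G C₀ (tr g) x₀ ≤ fiberSup G C₀ (tr d) x₀ + ε / 2 :=
        fiberSup_le_add fun z => by
          have := (abs_le.1 (hdg z)).2
          change f (g • z) ≤ f (d • z) + ε / 2
          linarith
      have h3 : fiberSup G C₀ (tr d) x₀ ≤ fiberSup G (C d) (tr d) x₀ :=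
        fiberSup_anti (subset_biUnion_of_mem hd)
      have h4 : fiberSup G F (tr d) x₀ ≤ fiberSup G F (tr g) x₀ + ε / 2 :=
        fiberSup_le_add fun z => by
          have := (abs_le.1 (hdg z)).1
          change f (d • z) ≤ f (g • z) + ε / 2
          linarith
      have h5 := hCeq d
      rw [fiberSup_smul, fiberSup_smul]
      change fiberSup G C₀ (tr g) x₀ ≤ fiberSup G F (tr g) x₀ + ε
      linarith
    have h2 : fiberSup G F f = fiberSup G C₀ f := by
      ext z
      refine le_antisymm (fiberSup_anti hUF) ?_
      -- Off the orbit, enlarge `C₀` by a countable `C'` that is exact at `z`. The suprema for `C₀`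
      -- and `C₀ ∪ C'` are continuous and agree on the dense orbit, so they agree at `z`.
      obtain ⟨C', hC'F, hC'c, hC'⟩ := exists_countable_fiberSup_eq (G := G) F f z
      have hu : (C₀ ∪ C').Countable := hUc.union hC'c
      have h3 : fiberSup G (C₀ ∪ C') f = fiberSup G C₀ f := by
        refine Continuous.ext_on h.dense_orbit
          (continuous_fiberSup (h.isOpenMap_mk_of_countable hG hu))
          (continuous_fiberSup (h.isOpenMap_mk_of_countable hG hUc)) ?_
        rintro _ ⟨g, rfl⟩
        exact le_antisymm (fiberSup_anti subset_union_left)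
          ((h1 g).trans (fiberSup_anti (union_subset hUF hC'F)))
      rw [← h3, ← hC']
      exact fiberSup_anti subset_union_right
    rw [h2]
    exact continuous_fiberSup (h.isOpenMap_mk_of_countable hG hUc)
  intro O hO
  rw [← TranslateQuotient.isQuotientMap_mk.isOpen_preimage, isOpen_iff_mem_nhds]
  rintro x ⟨y, hy, hyx⟩
  -- For `f` vanishing off `O` with `f y = 1`, every class on which the supremum of `f` is positive
  -- meets `O`.
  obtain ⟨f, hf0, hf1, -⟩ := exists_continuous_zero_one_of_isClosed
    hO.isClosed_compl (isClosed_singleton (x := y)) (by simpa using hy)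
  have h1 : 0 < fiberSup G F f x := lt_fiberSup_iff.2 ⟨y, hyx, by rw [hf1 rfl]; norm_num⟩
  filter_upwards [(isOpen_Ioi.preimage (key f)).mem_nhds h1] with z hz
  obtain ⟨w, hwz, hw⟩ := lt_fiberSup_iff.1 hz
  refine ⟨w, by_contra fun hwO => ?_, hwz⟩
  rw [hf0 hwO] at hw
  exact lt_irrefl _ hw

end FiberSup

/-! ### Continuous selection of probability measures -/

section Selection

variable {Ω : Type*} [TopologicalSpace Ω] {M : Type u} [PseudoMetricSpace M]

/-- A continuous family, indexed by `Ω`, of finitely supported probability measures on `M` such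
that the measure at `ω` is supported near `Γ ω`. -/
structure FiniteApprox (Γ : Ω → Set M) (ε : ℝ) where
  ι : Type u
  [fintype : Fintype ι]
  weight : ι → C(Ω, ℝ)
  point : ι → M
  nonneg : ∀ i ω, 0 ≤ weight i ω
  sum_eq_one : ∀ ω, ∑ i, weight i ω = 1
  near : ∀ i, ∀ ω ∈ tsupport (weight i), ∃ γ ∈ Γ ω, dist γ (point i) < ε

namespace FiniteApprox

attribute [instance] FiniteApprox.fintype

variable {Γ : Ω → Set M} {ε ε' ε'' : ℝ}

/-- Integration of the second variable. -/
noncomputable def eval (D : FiniteApprox Γ ε) : C(Ω × M, ℝ) →ₗ[ℝ] C(Ω, ℝ) where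
  toFun H := ∑ i, D.weight i * H.comp ((ContinuousMap.id Ω).prodMk (.const Ω (D.point i)))
  map_add' H H' := by
    rw [← Finset.sum_add_distrib]
    exact Finset.sum_congr rfl fun i _ => by ext; simp [mul_add]
  map_smul' c H := by
    rw [Finset.smul_sum]
    exact Finset.sum_congr rfl fun i _ => by ext; simp

theorem eval_apply (D : FiniteApprox Γ ε) (H : C(Ω × M, ℝ)) (ω : Ω) :
    D.eval H ω = ∑ i, D.weight i ω * H (ω, D.point i) := by
  simp [eval, ContinuousMap.sum_apply]

/-- `D'` refines `D` if it is obtained from `D` by spreading the mass of each point over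
points at distance at most `δ`. -/
def Refines (D : FiniteApprox Γ ε) (D' : FiniteApprox Γ ε') (δ : ℝ) : Prop :=
  ∃ π : D'.ι → D.ι, (∀ (φ : D.ι → ℝ) ω,
    ∑ j, D'.weight j ω * φ (π j) = ∑ i, D.weight i ω * φ i) ∧
    ∀ j, dist (D'.point j) (D.point (π j)) ≤ δ

theorem Refines.refl (D : FiniteApprox Γ ε) : D.Refines D 0 :=
  ⟨id, fun _ _ => rfl, fun _ => by simp⟩

theorem Refines.trans {D : FiniteApprox Γ ε} {D' : FiniteApprox Γ ε'} {D'' : FiniteApprox Γ ε''}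
    {δ δ' : ℝ} (h : D.Refines D' δ) (h' : D'.Refines D'' δ') : D.Refines D'' (δ + δ') := by
  obtain ⟨π, h1, h2⟩ := h
  obtain ⟨π', h1', h2'⟩ := h'
  refine ⟨π ∘ π', fun φ ω => (h1' (φ ∘ π) ω).trans (h1 φ ω), fun j => ?_⟩
  refine (dist_triangle _ (D'.point (π' j)) _).trans ?_
  have := h2 (π' j)
  have := h2' j
  simp only [Function.comp]
  linarith

theorem Refines.abs_eval_sub_le {D : FiniteApprox Γ ε} {D' : FiniteApprox Γ ε'} {δ η : ℝ}
    (h : D.Refines D' δ) {H : C(Ω × M, ℝ)} {ω : Ω}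
    (hH : ∀ a b, dist a b ≤ δ → |H (ω, a) - H (ω, b)| ≤ η) :
    |D'.eval H ω - D.eval H ω| ≤ η := by
  obtain ⟨π, h1, h2⟩ := h
  rw [eval_apply, eval_apply, ← h1 (fun i => H (ω, D.point i)), ← Finset.sum_sub_distrib]
  calc |∑ j, (D'.weight j ω * H (ω, D'.point j) - D'.weight j ω * H (ω, D.point (π j)))|
      ≤ ∑ j, |D'.weight j ω * H (ω, D'.point j) - D'.weight j ω * H (ω, D.point (π j))| :=
        Finset.abs_sum_le_sum_abs _ _
    _ ≤ ∑ j, D'.weight j ω * η := by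
        refine Finset.sum_le_sum fun j _ => ?_
        rw [← mul_sub, abs_mul, abs_of_nonneg (D'.nonneg j ω)]
        exact mul_le_mul_of_nonneg_left (hH _ _ (h2 j)) (D'.nonneg j ω)
    _ = η := by rw [← Finset.sum_mul, D'.sum_eq_one, one_mul]

theorem neg_le_eval (D : FiniteApprox Γ ε) {H : C(Ω × M, ℝ)} {ω : Ω} {η : ℝ}
    (hη : ∀ a b, dist a b < ε → |H (ω, a) - H (ω, b)| ≤ η) (hH : ∀ m ∈ Γ ω, 0 ≤ H (ω, m)) :
    -η ≤ D.eval H ω := by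
  have h1 : -η = ∑ i, D.weight i ω * (-η) := by
    rw [← Finset.sum_mul, D.sum_eq_one, one_mul]
  rw [eval_apply, h1]
  refine Finset.sum_le_sum fun i _ => ?_
  by_cases hi : D.weight i ω = 0
  · simp [hi]
  · obtain ⟨γ, hγ, hd⟩ := D.near i ω (subset_tsupport _ hi)
    have h2 := (abs_le.1 (hη γ _ hd)).2
    have h3 := hH γ hγ
    exact mul_le_mul_of_nonneg_left (by linarith) (D.nonneg i ω)

/-- On the compact set `tsupport (weight i)`, `Γ ω` always has a point within `ε` of `point i`.
Finitely many `ε'`-balls centred at points that near suffice to meet every such `Γ ω`, and a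
subordinate partition of unity splits `weight i` among their centres. -/
theorem exists_refines [CompactSpace Ω] [T2Space Ω]
    (hΓo : ∀ O : Set M, IsOpen O → IsOpen {ω | (Γ ω ∩ O).Nonempty})
    (D : FiniteApprox Γ ε) (hε' : 0 < ε') : ∃ D' : FiniteApprox Γ ε', D.Refines D' ε := by
  have key : ∀ i : D.ι, ∃ t : Finset M, (∀ m ∈ t, dist m (D.point i) ≤ ε) ∧
      ∃ p : PartitionOfUnity t Ω (tsupport (D.weight i)),
        p.IsSubordinate fun m => {ω | (Γ ω ∩ Metric.ball (m : M) ε').Nonempty} := by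
    intro i
    have hcov : tsupport (D.weight i) ⊆ ⋃ m ∈ Metric.ball (D.point i) ε,
        {ω | (Γ ω ∩ Metric.ball (m : M) ε').Nonempty} := by
      intro ω hω
      obtain ⟨γ, hγ, hd⟩ := D.near i ω hω
      exact mem_biUnion (Metric.mem_ball.2 hd) ⟨γ, hγ, Metric.mem_ball_self hε'⟩
    obtain ⟨t, ht, htf, htc⟩ := (isClosed_tsupport (D.weight i)).isCompact.elim_finite_subcover_image
      (fun m _ => hΓo _ Metric.isOpen_ball) hcov
    refine ⟨htf.toFinset, fun m hm => (Metric.mem_ball.1 (ht (htf.mem_toFinset.1 hm))).le, ?_⟩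
    refine PartitionOfUnity.exists_isSubordinate (isClosed_tsupport (D.weight i)) _
      (fun m => hΓo _ Metric.isOpen_ball) (htc.trans ?_)
    exact iUnion₂_subset fun m hm => subset_iUnion_of_subset ⟨m, htf.mem_toFinset.2 hm⟩ subset_rfl
  choose t ht p hp using key
  have hsum : ∀ i ω, ∑ m, D.weight i ω * p i m ω = D.weight i ω := by
    intro i ω
    rw [← Finset.mul_sum]
    by_cases hω : ω ∈ tsupport (D.weight i)
    · rw [← finsum_eq_sum_of_fintype, (p i).sum_eq_one hω, mul_one]
    · rw [image_eq_zero_of_notMem_tsupport hω, zero_mul]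
  refine ⟨{ ι := Σ i, t i
            weight := fun j => D.weight j.1 * p j.1 j.2
            point := fun j => j.2
            nonneg := fun j ω => mul_nonneg (D.nonneg _ _) ((p j.1).nonneg _ _)
            sum_eq_one := fun ω => ?_
            near := fun j ω hω => ?_ }, Sigma.fst, fun φ ω => ?_, fun j => ht j.1 _ j.2.2⟩
  · rw [Fintype.sum_sigma, ← D.sum_eq_one ω]
    exact Finset.sum_congr rfl fun i _ => hsum i ω
  · obtain ⟨γ, hγ, hd⟩ := hp j.1 j.2 (tsupport_mul_subset_right hω)
    exact ⟨γ, hγ, hd⟩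
  · rw [Fintype.sum_sigma]
    refine Finset.sum_congr rfl fun i _ => ?_
    rw [← hsum i ω, Finset.sum_mul]
    rfl

end FiniteApprox

/-- A selection theorem for probability measures: a lower semicontinuous family `Γ` of nonempty
subsets of a compact metric space carries a continuous family of probability measures, given here
as integration of the second variable. -/
theorem exists_fiberwise_integral [CompactSpace Ω] [T2Space Ω] [CompactSpace M] [Nonempty M]
    {Γ : Ω → Set M} (hΓ : ∀ ω, (Γ ω).Nonempty)
    (hΓo : ∀ O : Set M, IsOpen O → IsOpen {ω | (Γ ω ∩ O).Nonempty}) :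
    ∃ s : C(Ω × M, ℝ) →ₗ[ℝ] C(Ω, ℝ), s 1 = 1 ∧
      ∀ H ω, (∀ m ∈ Γ ω, 0 ≤ H (ω, m)) → 0 ≤ s H ω := by
  -- The summand `1` gives the strict inequality that lets a single arbitrary point serve as the
  -- initial approximation.
  let R : ℝ := Metric.diam (univ : Set M) + 1
  have hR : 0 < R := add_pos_of_nonneg_of_pos Metric.diam_nonneg one_pos
  let r : ℕ → ℝ := fun n => R / 2 ^ n
  have hr : ∀ n, 0 < r n := fun n => by positivity
  have hr2 : ∀ n, r n = 2 * r (n + 1) := fun n => by simp only [r, pow_succ]; field_simp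
  have hr0 : Tendsto r atTop (𝓝 0) :=
    tendsto_const_nhds.div_atTop (tendsto_pow_atTop_atTop_of_one_lt one_lt_two)
  let D₀ : FiniteApprox Γ (r 0) :=
    { ι := PUnit
      weight := fun _ => 1
      point := fun _ => Classical.arbitrary M
      nonneg := fun _ _ => zero_le_one
      sum_eq_one := fun _ => by simp
      near := fun _ ω _ => by
        obtain ⟨γ, hγ⟩ := hΓ ω
        refine ⟨γ, hγ, ?_⟩
        have := Metric.dist_le_diam_of_mem (isCompact_univ (X := M)).isBounded
          (mem_univ γ) (mem_univ (Classical.arbitrary M))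
        simp only [r, R, pow_zero, div_one]
        linarith }
  choose next hnext using fun n (D : FiniteApprox Γ (r n)) => D.exists_refines hΓo (hr (n + 1))
  let D : ∀ n, FiniteApprox Γ (r n) := fun n => Nat.rec D₀ next n
  have hstep : ∀ n, (D n).Refines (D (n + 1)) (r n) := fun n => hnext n (D n)
  -- The displacements `r n + ... + r (n + k - 1)` telescope, because `r n = 2 * r n - 2 * r (n +
  -- 1)`.
  have href : ∀ n k, (D n).Refines (D (n + k)) (2 * r n - 2 * r (n + k)) := by
    intro n k
    induction k with
    | zero => simpa using FiniteApprox.Refines.refl (D n)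
    | succ k ih =>
      have := ih.trans (hstep (n + k))
      have h2 := hr2 (n + k)
      rw [show 2 * r n - 2 * r (n + k) + r (n + k) = 2 * r n - 2 * r (n + (k + 1)) by
        rw [← add_assoc]; linarith] at this
      exact this
  have hunif : ∀ (H : C(Ω × M, ℝ)) (η : ℝ), 0 < η → ∃ δ > 0, ∀ ω a b, dist a b < δ →
      |H (ω, a) - H (ω, b)| ≤ η := by
    intro H η hη
    -- The uniformity of the compact space `Ω` makes `H` uniformly continuous, so one `δ` serves all
    -- sections `H (ω, ·)`.
    let _ := uniformSpaceOfCompactR1 (γ := Ω)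
    have hu := CompactSpace.uniformContinuous_of_continuous H.continuous
    have h1 : Tendsto (fun q : Ω × (M × M) => ((q.1, q.2.1), (q.1, q.2.2)))
        (⊤ ×ˢ uniformity M) (uniformity (Ω × M)) := by
      rw [uniformity_prod_eq_comap_prod, tendsto_comap_iff]
      refine Tendsto.prodMk ?_ ?_
      · refine tendsto_iff_forall_eventually_mem.2 fun s hs => Eventually.of_forall fun q => ?_
        exact refl_mem_uniformity hs
      · exact tendsto_snd
    have h2 := (Tendsto.comp hu h1).eventually (Metric.dist_mem_uniformity hη)
    rw [eventually_iff, mem_prod_iff] at h2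
    obtain ⟨A, hA, B, hB, hAB⟩ := h2
    rw [mem_top] at hA
    subst hA
    obtain ⟨δ, hδ, hδB⟩ := Metric.mem_uniformity_dist.1 hB
    refine ⟨δ, hδ, fun ω a b hab => ?_⟩
    have h3 := hAB (mk_mem_prod (mem_univ ω) (hδB hab))
    exact le_of_lt h3
  have hcauchy : ∀ H, CauchySeq fun n => (D n).eval H := by
    intro H
    refine Metric.cauchySeq_iff'.2 fun η hη => ?_
    obtain ⟨δ, hδ, hH⟩ := hunif H (η / 2) (by positivity)
    obtain ⟨N, hN⟩ := (hr0.eventually (gt_mem_nhds (show 0 < δ / 2 by positivity))).exists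
    refine ⟨N, fun n hn => ?_⟩
    obtain ⟨k, rfl⟩ := Nat.exists_eq_add_of_le hn
    refine lt_of_le_of_lt ((ContinuousMap.dist_le (by positivity)).2 fun ω => ?_)
      (half_lt_self hη)
    rw [Real.dist_eq]
    refine (href N k).abs_eval_sub_le fun a b hab => hH ω a b ?_
    have := hr (N + k)
    linarith
  choose s hs using fun H => cauchySeq_tendsto_of_complete (hcauchy H)
  refine ⟨{ toFun := s, map_add' := fun H H' => ?_, map_smul' := fun c H => ?_ }, ?_, ?_⟩
  · refine tendsto_nhds_unique (hs (H + H')) ?_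
    simpa only [map_add] using (hs H).add (hs H')
  · refine tendsto_nhds_unique (hs (c • H)) ?_
    simpa only [map_smul, RingHom.id_apply] using (hs H).const_smul c
  · refine tendsto_nhds_unique (hs 1) ?_
    have : ∀ n, (D n).eval (1 : C(Ω × M, ℝ)) = 1 := fun n => by
      ext ω
      rw [FiniteApprox.eval_apply]
      simpa using (D n).sum_eq_one ω
    simp only [this]
    exact tendsto_const_nhds
  · intro H ω hH
    have hlim := ((continuous_eval_const (F := C(Ω, ℝ)) ω).tendsto (s H)).comp (hs H)
    refine le_of_forall_pos_le_add fun η hη => ?_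
    obtain ⟨δ, hδ, hHδ⟩ := hunif H η hη
    have hev : ∀ᶠ n in atTop, -η ≤ (D n).eval H ω := by
      filter_upwards [hr0.eventually (gt_mem_nhds hδ)] with n hn
      exact (D n).neg_le_eval (fun a b hab => hHδ ω a b (hab.trans hn)) hH
    have := ge_of_tendsto hlim hev
    change -η ≤ s H ω at this
    change 0 ≤ s H ω + η
    linarith

end Selection

/-! ### Functions factoring through a quotient -/

section Factor

/-- A continuous function on a compact space which is constant on the fibers of a continuous map
to a compact Hausdorff space factors through it. -/
theorem ContinuousMap.exists_comp_eq_of_forall_eq {K Z : Type*} [TopologicalSpace K]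
    [CompactSpace K] [TopologicalSpace Z] [CompactSpace Z] [T2Space Z] (e : C(K, Z)) (h : C(K, ℝ))
    (he : ∀ x y, e x = e y → h x = h y) : ∃ H : C(Z, ℝ), ∀ x, H (e x) = h x := by
  let e' : C(K, range e) := ⟨rangeFactorization e, e.continuous.subtype_mk _⟩
  have hq : IsQuotientMap e' :=
    e'.continuous.isClosedMap.isQuotientMap e'.continuous rangeFactorization_surjective
  -- `h` descends to the closed range of `e`, from which Tietze's theorem extends it.
  obtain ⟨H, hH⟩ := ContinuousMap.exists_restrict_eq (isCompact_range e.continuous).isClosed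
    (hq.lift h fun x y hxy => he x y (congr_arg Subtype.val hxy))
  refine ⟨H, fun x => ?_⟩
  have h1 := DFunLike.congr_fun hH (e' x)
  have h2 := DFunLike.congr_fun (hq.lift_comp h fun x y hxy => he x y (congr_arg Subtype.val hxy)) x
  exact h1.trans h2

variable {G : Type v} [Group G] {K : Type u} [TopologicalSpace K] [MulAction G K]

variable (G) in
/-- The continuous functions that factor through `TranslateQuotient G F`. -/
def factorSubmodule (F : Set C(K, ℝ)) : Submodule ℝ C(K, ℝ) where
  carrier := {h | ∀ x y, TranslateQuotient.mk G F x = TranslateQuotient.mk G F y → h x = h y}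
  add_mem' ha hb x y hxy := by simp [ha x y hxy, hb x y hxy]
  zero_mem' _ _ _ := rfl
  smul_mem' c h hh x y hxy := by simp [hh x y hxy]

theorem mem_factorSubmodule {F : Set C(K, ℝ)} {h : C(K, ℝ)} : h ∈ factorSubmodule G F ↔
    ∀ x y, TranslateQuotient.mk G F x = TranslateQuotient.mk G F y → h x = h y := Iff.rfl

theorem subset_factorSubmodule {F : Set C(K, ℝ)} {f : C(K, ℝ)} (hf : f ∈ F) :
    f ∈ factorSubmodule G F := fun x y hxy => by
  simpa using TranslateQuotient.mk_eq_mk.1 hxy f hf 1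

theorem comp_mk_mem_factorSubmodule {F : Set C(K, ℝ)} (ψ : C(TranslateQuotient G F, ℝ)) :
    ψ.comp ⟨_, TranslateQuotient.continuous_mk⟩ ∈ factorSubmodule G F :=
  fun _ _ hxy => congr_arg ψ hxy

theorem factorSubmodule_mono {F F' : Set C(K, ℝ)} (h : F ⊆ F') :
    factorSubmodule G F ≤ factorSubmodule G F' :=
  fun _ hf x y hxy => hf x y (congr_arg (TranslateQuotient.map h) hxy)

theorem isClosed_factorSubmodule (F : Set C(K, ℝ)) :
    IsClosed (factorSubmodule G F : Set C(K, ℝ)) := by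
  have : (factorSubmodule G F : Set C(K, ℝ)) =
      ⋂ (x) (y) (_ : TranslateQuotient.mk G F x = TranslateQuotient.mk G F y),
        {h | h x = h y} := by
    ext h
    simp [mem_factorSubmodule]
  rw [this]
  exact isClosed_iInter fun x => isClosed_iInter fun y => isClosed_iInter fun _ =>
    isClosed_eq (continuous_eval_const x) (continuous_eval_const y)

/-- The Stone–Weierstrass theorem for invariant subalgebras. -/
theorem Subalgebra.topologicalClosure_eq_factorSubmodule [CompactSpace K]
    [ContinuousConstSMul G K] (B : Subalgebra ℝ C(K, ℝ))
    (hB : ∀ (g : G), ∀ f ∈ B, f.comp ⟨fun x : K => g • x, continuous_const_smul g⟩ ∈ B) :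
    (Subalgebra.toSubmodule B).topologicalClosure = factorSubmodule G (B : Set C(K, ℝ)) := by
  refine le_antisymm ?_ ?_
  · exact Submodule.topologicalClosure_minimal _ (fun f hf => subset_factorSubmodule hf)
      (isClosed_factorSubmodule _)
  · intro h hh
    let q : C(K, TranslateQuotient G (B : Set C(K, ℝ))) := ⟨_, TranslateQuotient.continuous_mk⟩
    obtain ⟨H, hH⟩ := ContinuousMap.exists_comp_eq_of_forall_eq q h hh
    have hHh : H.comp q = h := ContinuousMap.ext hH
    have hsep : (B.comap (ContinuousMap.compRightAlgHom ℝ ℝ q)).SeparatesPoints := by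
      refine TranslateQuotient.surjective_mk.forall₂.2 fun x y hxy => ?_
      rw [Ne, TranslateQuotient.mk_eq_mk] at hxy
      push Not at hxy
      obtain ⟨f, hf, g, hfg⟩ := hxy
      exact ⟨_, ⟨TranslateQuotient.lift f hf g, hB g f hf, rfl⟩, hfg⟩
    have htop := ContinuousMap.subalgebra_topologicalClosure_eq_top_of_separatesPoints _ hsep
    have hmem : H ∈ closure ((B.comap (ContinuousMap.compRightAlgHom ℝ ℝ q) : Subalgebra ℝ _) :
        Set C(TranslateQuotient G (B : Set C(K, ℝ)), ℝ)) := by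
      rw [← Subalgebra.topologicalClosure_coe, htop]
      trivial
    have h1 := map_mem_closure (ContinuousMap.compRightContinuousMap ℝ q).continuous hmem
      (t := (B : Set C(K, ℝ))) fun φ hφ => hφ
    rw [← hHh]
    exact h1

end Factor

/-! ### Partial regular extension operators -/

section PartialExtension

variable {K : Type*} [TopologicalSpace K] {Y : Type*} [TopologicalSpace Y]

/-- A partially defined linear, positive and unital extension operator along `i`. -/
structure IsPartialRegularExtension (i : K → Y) (T : C(K, ℝ) →ₗ.[ℝ] C(Y, ℝ)) : Prop where
  one_mem : 1 ∈ T.domain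
  map_one : T ⟨1, one_mem⟩ = 1
  nonneg : ∀ f : T.domain, 0 ≤ (f : C(K, ℝ)) → 0 ≤ T f
  apply_apply : ∀ (f : T.domain) k, T f (i k) = (f : C(K, ℝ)) k

namespace IsPartialRegularExtension

variable {i : K → Y} {T : C(K, ℝ) →ₗ.[ℝ] C(Y, ℝ)}

theorem apply_le (hT : IsPartialRegularExtension i T) {f : T.domain} {c : ℝ}
    (hf : ∀ k, (f : C(K, ℝ)) k ≤ c) (y : Y) : T f y ≤ c := by
  have h1 := hT.nonneg (c • ⟨1, hT.one_mem⟩ - f) fun k => by simpa using hf k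
  have h2 := h1 y
  rw [LinearPMap.map_sub, LinearPMap.map_smul, hT.map_one] at h2
  simpa using h2

variable [CompactSpace K] [CompactSpace Y]

theorem norm_apply_le (hT : IsPartialRegularExtension i T) (f : T.domain) : ‖T f‖ ≤ 1 * ‖f‖ := by
  rw [one_mul]
  refine (ContinuousMap.norm_le _ (norm_nonneg f)).2 fun y => ?_
  rw [Real.norm_eq_abs, abs_le]
  have hb : ∀ k, |(f : C(K, ℝ)) k| ≤ ‖f‖ := fun k => (f : C(K, ℝ)).norm_coe_le_norm k
  refine ⟨?_, hT.apply_le (fun k => (abs_le.1 (hb k)).2) y⟩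
  have := hT.apply_le (f := -f) (c := ‖f‖)
    (fun k => neg_le.1 (abs_le.1 (hb k)).1) y
  rw [LinearPMap.map_neg] at this
  exact neg_le.1 this

/-- A positive unital operator is a contraction, so it extends to the closure of its domain. A
nonnegative limit may be approximated only by functions `≥ -ε`, but their images are `≥ -ε` too,
which is enough for positivity. -/
theorem exists_extension_closure (hT : IsPartialRegularExtension i T) :
    ∃ T', T ≤ T' ∧ T'.domain = T.domain.topologicalClosure ∧ IsPartialRegularExtension i T' := by
  let T₀ : T.domain →L[ℝ] C(Y, ℝ) := T.toFun.mkContinuous 1 hT.norm_apply_le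
  have hsub : T.domain ≤ T.domain.topologicalClosure := T.domain.le_topologicalClosure
  let e : T.domain →L[ℝ] T.domain.topologicalClosure :=
    (Submodule.inclusion hsub).mkContinuous 1 fun f => by simp
  have he : IsUniformInducing e := by
    have : Isometry e := AddMonoidHomClass.isometry_of_norm e fun f => rfl
    exact this.isUniformInducing
  have hd : DenseRange e := by
    intro f
    rw [closure_subtype]
    refine closure_mono ?_ f.2
    intro g hg
    exact ⟨⟨g, hsub hg⟩, ⟨⟨g, hg⟩, rfl⟩, rfl⟩
  let T' : C(K, ℝ) →ₗ.[ℝ] C(Y, ℝ) :=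
    ⟨T.domain.topologicalClosure, (T₀.extend e : _ →ₗ[ℝ] C(Y, ℝ))⟩
  have hT' : ∀ f : T.domain, T' (e f) = T f := fun f => T₀.extend_eq hd he f
  have hcont : Continuous fun f : T.domain.topologicalClosure => T' f := (T₀.extend e).continuous
  have hle : T ≤ T' := ⟨hsub, fun f g hfg => by
    rw [← hT' f]
    exact congr_arg _ (Subtype.ext hfg)⟩
  refine ⟨T', hle, rfl, ⟨hsub hT.one_mem, ?_, ?_, ?_⟩⟩
  · rw [← hT.map_one]
    exact hT' ⟨1, hT.one_mem⟩
  · intro f hf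
    have hlow : ∀ ε > 0, ∀ y, -ε ≤ T' f y := by
      intro ε hε y
      have hmem : f ∈ closure (range e ∩ Metric.ball f ε) := by
        refine mem_closure_iff_nhds.2 fun W hW => ?_
        obtain ⟨z, hz, hz'⟩ := mem_closure_iff_nhds.1 (hd f) _
          (Filter.inter_mem hW (Metric.ball_mem_nhds f hε))
        exact ⟨z, hz.1, hz', hz.2⟩
      have hcl : IsClosed {g : T.domain.topologicalClosure | -ε ≤ T' g y} :=
        isClosed_le continuous_const ((continuous_eval_const (F := C(Y, ℝ)) y).comp hcont)
      refine closure_minimal ?_ hcl hmem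
      rintro _ ⟨⟨g, rfl⟩, hg⟩
      have h1 := hT.apply_le (f := -g) (c := ε) (fun k => by
        have h2 : dist ((g : C(K, ℝ)) k) ((f : C(K, ℝ)) k) ≤ dist (g : C(K, ℝ)) f :=
          ContinuousMap.dist_apply_le_dist k
        have h3 : dist (g : C(K, ℝ)) f < ε := hg
        have h4 := (abs_le.1 ((Real.dist_eq _ _).symm.trans_le h2)).1
        have h5 : 0 ≤ (f : C(K, ℝ)) k := hf k
        change -(g : C(K, ℝ)) k ≤ ε
        linarith) y
      rw [LinearPMap.map_neg] at h1
      change -ε ≤ T' (e g) y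
      rw [hT']
      exact neg_le.1 h1
    intro y
    refine le_of_forall_pos_le_add fun ε hε => ?_
    have := hlow ε hε y
    change 0 ≤ T' f y + ε
    linarith
  · intro f k
    have hcl : IsClosed {g : T.domain.topologicalClosure | T' g (i k) = (g : C(K, ℝ)) k} :=
      isClosed_eq ((continuous_eval_const (F := C(Y, ℝ)) (i k)).comp hcont)
        ((continuous_eval_const (F := C(K, ℝ)) k).comp continuous_subtype_val)
    refine closure_minimal ?_ hcl (hd f)
    rintro _ ⟨g, rfl⟩
    change T' (e g) (i k) = (g : C(K, ℝ)) k
    rw [hT', hT.apply_apply]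

end IsPartialRegularExtension

end PartialExtension

/-! ### Metrizability of countably generated quotients -/

section Metrizable

variable {G : Type v} [Group G] [TopologicalSpace G] {X : Type u} [TopologicalSpace X]
  [MulAction G X] [ContinuousConstSMul G X]

/-- Quotients given by countably many orbit uniform functions admit continuous injections into
second countable metrizable spaces. -/
theorem TranslateQuotient.exists_continuous_injective (hG : IsOmegaNarrow G) {F : Set C(X, ℝ)}
    (hFc : F.Countable) (hF : ∀ f ∈ F, IsOrbitUniform G f) :
    ∃ (ι : Type (max u v)) (_ : Countable ι) (Φ : TranslateQuotient G F → ι → ℝ),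
      Continuous Φ ∧ Function.Injective Φ := by
  obtain ⟨S, hS, hSF⟩ := exists_countable_mk_eq_mk_iff hG hFc hF
  refine ⟨S, hS, fun z s => lift s.1.1.1 s.1.1.2 s.1.2 z, by fun_prop, ?_⟩
  refine surjective_mk.forall₂.2 fun x y hxy => hSF x y fun s hs => ?_
  exact congr_fun hxy ⟨s, hs⟩

theorem TranslateQuotient.metrizableSpace [CompactSpace X] (hG : IsOmegaNarrow G)
    {F : Set C(X, ℝ)} (hFc : F.Countable) (hF : ∀ f ∈ F, IsOrbitUniform G f) :
    TopologicalSpace.MetrizableSpace (TranslateQuotient G F) := by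
  obtain ⟨ι, _, Φ, hΦ, hΦi⟩ := exists_continuous_injective hG hFc hF
  exact (hΦ.isClosedEmbedding hΦi).isEmbedding.metrizableSpace

end Metrizable

/-! ### Prolonging an extension operator by one function -/

section Extension

variable {G : Type v} [Group G] {K : Type u} [TopologicalSpace K] [CompactSpace K]
  [MulAction G K] [ContinuousConstSMul G K] {Y : Type u} [TopologicalSpace Y] [CompactSpace Y]
  [T2Space Y]

open TranslateQuotient in
/-- The operator from functions on `TranslateQuotient G F × M` to functions on `Y`, obtained from
a partial extension operator for the functions on `TranslateQuotient G F`, where the sets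
`{m z | mk z = ζ}` depend lower semicontinuously on `ζ`. -/
theorem exists_operator_of_partialRegularExtension [Nonempty K] {i : K → Y} (hi : IsEmbedding i)
    {F : Set C(K, ℝ)} (hF : IsOpenMap (mk G F)) {T : C(K, ℝ) →ₗ.[ℝ] C(Y, ℝ)}
    (hT : IsPartialRegularExtension i T) (hTd : T.domain = factorSubmodule G F)
    {M : Type u} [PseudoMetricSpace M] [CompactSpace M] [T2Space M] {m : K → M} (hm : Continuous m) :
    ∃ P : C(TranslateQuotient G F × M, ℝ) →ₗ[ℝ] C(Y, ℝ),
      (∀ H, (∀ z, 0 ≤ H (mk G F z, m z)) → 0 ≤ P H) ∧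
      (∀ (h : T.domain) (ψ : C(TranslateQuotient G F, ℝ)), (∀ z, ψ (mk G F z) = (h : C(K, ℝ)) z) →
        P (ψ.comp ContinuousMap.fst) = T h) ∧
      ∀ H k, P H (i k) = H (mk G F k, m k) := by
  let Q := TranslateQuotient G F
  let j : K → Y × Q := fun k => (i k, mk G F k)
  have hj : Continuous j := hi.continuous.prodMk continuous_mk
  have hji : ∀ k k', j k = j k' → k = k' := fun k k' h => hi.injective (congr_arg Prod.fst h)
  -- Over `(y, ζ)` this is the image under `m` of the class `ζ`, cut down to the single point `m k`
  -- over `j k`. The cut enforces the extension property, and it preserves lower semicontinuity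
  -- because `j` maps compact sets to closed sets.
  let Γ : Y × Q → Set M := fun ω => {x | (∃ z, mk G F z = ω.2 ∧ m z = x) ∧ ∀ k, j k = ω → x = m k}
  have hΓ : ∀ ω, (Γ ω).Nonempty := by
    intro ω
    by_cases hω : ∃ k, j k = ω
    · obtain ⟨k, rfl⟩ := hω
      exact ⟨m k, ⟨k, rfl, rfl⟩, fun k' hk' => by rw [hji _ _ hk']⟩
    · obtain ⟨z, hz⟩ := surjective_mk ω.2
      exact ⟨m z, ⟨z, hz, rfl⟩, fun k hk => (hω ⟨k, hk⟩).elim⟩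
  have hΓo : ∀ O : Set M, IsOpen O → IsOpen {ω | (Γ ω ∩ O).Nonempty} := by
    intro O hO
    have h1 : {ω | (Γ ω ∩ O).Nonempty} =
        Prod.snd ⁻¹' (mk G F '' (m ⁻¹' O)) ∩ (j '' (m ⁻¹' O)ᶜ)ᶜ := by
      ext ω
      constructor
      · rintro ⟨_, ⟨⟨z, hz, rfl⟩, hk⟩, hO⟩
        refine ⟨⟨z, hO, hz⟩, ?_⟩
        rintro ⟨k, hkO, hkω⟩
        refine hkO ?_
        rw [mem_preimage, ← hk k hkω]
        exact hO
      · rintro ⟨⟨z, hz, hzω⟩, hω⟩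
        by_cases hk : ∃ k, j k = ω
        · obtain ⟨k, rfl⟩ := hk
          refine ⟨m k, ⟨⟨k, rfl, rfl⟩, fun k' hk' => by rw [hji _ _ hk']⟩, ?_⟩
          by_contra hkO
          exact hω ⟨k, hkO, rfl⟩
        · exact ⟨m z, ⟨⟨z, hzω, rfl⟩, fun k hk' => (hk ⟨k, hk'⟩).elim⟩, hz⟩
    rw [h1]
    refine ((hF _ (hO.preimage hm)).preimage continuous_snd).inter ?_
    rw [isOpen_compl_iff]
    exact ((hO.preimage hm).isClosed_compl.isCompact.image hj).isClosed
  have : Nonempty M := ‹Nonempty K›.map m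
  obtain ⟨s, hs1, hs⟩ := exists_fiberwise_integral hΓ hΓo
  have hs_const : ∀ (H : C((Y × Q) × M, ℝ)) ω c, (∀ x ∈ Γ ω, H (ω, x) = c) → s H ω = c := by
    intro H ω c hc
    have h1 := hs (H - c • 1) ω fun x hx => by simp [hc x hx]
    have h2 := hs (c • 1 - H) ω fun x hx => by simp [hc x hx]
    rw [map_sub, map_smul, hs1] at h1 h2
    simp only [ContinuousMap.sub_apply, ContinuousMap.smul_apply, ContinuousMap.one_apply,
      smul_eq_mul, mul_one] at h1 h2
    linarith
  let pull : C((Y × Q) × M, Q × M) := ⟨fun p => (p.1.2, p.2), by fun_prop⟩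
  let q : C(K, Q) := ⟨_, continuous_mk⟩
  let L : C(Q × M, ℝ) →ₗ[ℝ] C(Y × Q, ℝ) :=
    s ∘ₗ (ContinuousMap.compRightAlgHom ℝ ℝ pull).toLinearMap
  have hL : ∀ H, L H = s (H.comp pull) := fun H => rfl
  have hmem : ∀ ψ : C(Q, ℝ), ψ.comp q ∈ T.domain := fun ψ => by
    rw [hTd]
    exact comp_mk_mem_factorSubmodule ψ
  let T₀ : T.domain →L[ℝ] C(Y, ℝ) := T.toFun.mkContinuous 1 hT.norm_apply_le
  -- For fixed `y`, integrating out `M` leaves a function of the class alone, to which `T` applies;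
  -- the result is then evaluated at the same `y`.
  let sec : C(Q × M, ℝ) → Y → T.domain := fun H y => ⟨((L H).curry y).comp q, hmem _⟩
  have hsec : ∀ H, Continuous (sec H) := fun H =>
    ((ContinuousMap.compRightContinuousMap ℝ q).continuous.comp (L H).curry.continuous).subtype_mk _
  let P₀ : C(Q × M, ℝ) → C(Y, ℝ) := fun H =>
    ⟨fun y => T₀ (sec H y) y, by
      have h1 : Continuous fun y => T₀ (sec H y) := T₀.continuous.comp (hsec H)
      exact h1.eval continuous_id⟩
  have hP₀ : ∀ H y, P₀ H y = T (sec H y) y := fun _ _ => rfl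
  refine ⟨{ toFun := P₀, map_add' := fun H H' => ?_, map_smul' := fun c H => ?_ }, ?_, ?_, ?_⟩
  · ext y
    have h1 : sec (H + H') y = sec H y + sec H' y := Subtype.ext (by
      ext k
      simp [sec])
    rw [ContinuousMap.add_apply, hP₀, hP₀, hP₀, h1, LinearPMap.map_add, ContinuousMap.add_apply]
  · ext y
    have h1 : sec (c • H) y = c • sec H y := Subtype.ext (by
      ext k
      simp [sec])
    rw [RingHom.id_apply, ContinuousMap.smul_apply, hP₀, hP₀, h1, LinearPMap.map_smul]
    rfl
  · intro H hH y
    refine hT.nonneg (sec H y) (fun k => ?_) y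
    refine hs (H.comp pull) (y, mk G F k) ?_
    rintro _ ⟨⟨z, hz, rfl⟩, -⟩
    have := hH z
    rw [hz] at this
    exact this
  · intro h ψ hψ
    ext y
    have h1 : sec (ψ.comp ContinuousMap.fst) y = h := Subtype.ext (by
      ext k
      rw [← hψ k]
      exact hs_const _ (y, mk G F k) _ fun x _ => rfl)
    change P₀ _ y = _
    rw [hP₀, h1]
  · intro H k
    change P₀ _ _ = _
    rw [hP₀, hT.apply_apply]
    refine hs_const (H.comp pull) (j k) _ ?_
    rintro x ⟨-, hx⟩
    rw [hx k rfl]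
    rfl

-- Functions that factor through the larger quotient live on the image of `K` in the product of the
-- old quotient with the metrizable quotient by `f`. The operator `P` is positive, so it depends
-- only on values on that image; hence arbitrary extensions of these functions to the product still
-- yield a linear operator.
open TranslateQuotient in
theorem exists_partialRegularExtension_insert [TopologicalSpace G]
    (hG : IsOmegaNarrow G) [Nonempty K] {i : K → Y} (hi : IsEmbedding i) {F : Set C(K, ℝ)}
    (hF : IsOpenMap (mk G F)) {T : C(K, ℝ) →ₗ.[ℝ] C(Y, ℝ)} (hT : IsPartialRegularExtension i T)
    (hTd : T.domain = factorSubmodule G F) {f : C(K, ℝ)} (hf : IsOrbitUniform G f) :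
    ∃ T', T ≤ T' ∧ T'.domain = factorSubmodule G (insert f F) ∧
      IsPartialRegularExtension i T' := by
  have := TranslateQuotient.metrizableSpace hG (countable_singleton f) (by simpa using hf)
  let _ := TopologicalSpace.metrizableSpaceMetric (TranslateQuotient G {f})
  obtain ⟨P, hPn, hPT, hPi⟩ := exists_operator_of_partialRegularExtension hi hF hT hTd
    (continuous_mk : Continuous (mk G {f}))
  let e : C(K, TranslateQuotient G F × TranslateQuotient G {f}) :=
    ⟨fun z => (mk G F z, mk G {f} z), continuous_mk.prodMk continuous_mk⟩
  have hle : F ⊆ insert f F := subset_insert f F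
  have hex : ∀ h : factorSubmodule G (insert f F), ∃ H : C(TranslateQuotient G F ×
      TranslateQuotient G {f}, ℝ), ∀ z, H (e z) = (h : C(K, ℝ)) z := by
    intro h
    refine ContinuousMap.exists_comp_eq_of_forall_eq e h fun x y hxy => h.2 x y (mk_eq_mk.2 ?_)
    rintro φ (rfl | hφ)
    · exact mk_eq_mk.1 (congr_arg Prod.snd hxy) φ rfl
    · exact mk_eq_mk.1 (congr_arg Prod.fst hxy) φ hφ
  choose ext hext using hex
  have hPeq : ∀ H H', (∀ z, H (e z) = H' (e z)) → P H = P H' := by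
    intro H H' h
    refine le_antisymm ?_ ?_
    · rw [← sub_nonneg, ← map_sub]
      exact hPn _ fun z => sub_nonneg.2 (h z).le
    · rw [← sub_nonneg, ← map_sub]
      exact hPn _ fun z => sub_nonneg.2 (h z).ge
  let T' : C(K, ℝ) →ₗ.[ℝ] C(Y, ℝ) :=
    ⟨factorSubmodule G (insert f F),
      { toFun := fun h => P (ext h)
        map_add' := fun h h' => by
          rw [← map_add]
          refine hPeq _ _ fun z => ?_
          rw [ContinuousMap.add_apply, hext, hext, hext]
          rfl
        map_smul' := fun c h => by
          rw [RingHom.id_apply, ← map_smul]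
          refine hPeq _ _ fun z => ?_
          rw [ContinuousMap.smul_apply, hext, hext]
          rfl }⟩
  have hT' : ∀ h, T' h = P (ext h) := fun _ => rfl
  have hTT' : T ≤ T' := by
    refine ⟨hTd.le.trans (factorSubmodule_mono hle), fun h h' hh => ?_⟩
    have hh2 : (h : C(K, ℝ)) ∈ factorSubmodule G F := hTd ▸ h.2
    obtain ⟨ψ, hψ⟩ := ContinuousMap.exists_comp_eq_of_forall_eq
      (⟨_, continuous_mk⟩ : C(K, TranslateQuotient G F)) h hh2
    rw [hT', ← hPT h ψ hψ]
    refine hPeq _ _ fun z => ?_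
    rw [hext, ← hh, ← hψ z]
    rfl
  refine ⟨T', hTT', rfl, ⟨hTT'.1 hT.one_mem, ?_, fun h hh => ?_, fun h k => ?_⟩⟩
  · rw [← hT.map_one]
    exact (hTT'.2 rfl).symm
  · refine hPn _ fun z => ?_
    rw [show (mk G F z, mk G {f} z) = e z from rfl, hext]
    exact hh z
  · rw [hT', hPi, show (mk G F k, mk G {f} k) = e k from rfl, hext]

end Extension

/-! ### Existence of extension operators by Zorn's lemma -/

section Zorn

variable {G : Type v} [Group G] {K : Type u} [TopologicalSpace K] [MulAction G K]
  [ContinuousConstSMul G K] {Y : Type u} [TopologicalSpace Y]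

variable (G) in
/-- Partial regular extension operators defined on invariant subalgebras. -/
structure IsInvariantRegularExtension (i : K → Y) (T : C(K, ℝ) →ₗ.[ℝ] C(Y, ℝ)) : Prop where
  regular : IsPartialRegularExtension i T
  mul_mem : ∀ f ∈ T.domain, ∀ f' ∈ T.domain, f * f' ∈ T.domain
  comp_mem : ∀ (g : G), ∀ f ∈ T.domain,
    f.comp ⟨fun x : K => g • x, continuous_const_smul g⟩ ∈ T.domain

theorem IsPartialRegularExtension.isInvariantRegularExtension {i : K → Y}
    {T : C(K, ℝ) →ₗ.[ℝ] C(Y, ℝ)} (hT : IsPartialRegularExtension i T) {F : Set C(K, ℝ)}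
    (hF : T.domain = factorSubmodule G F) : IsInvariantRegularExtension G i T where
  regular := hT
  mul_mem f hf f' hf' := by
    rw [hF] at hf hf' ⊢
    intro x y hxy
    simp [hf x y hxy, hf' x y hxy]
  comp_mem g f hf := by
    rw [hF] at hf ⊢
    intro x y hxy
    refine hf (g • x) (g • y) ?_
    rw [TranslateQuotient.mk_smul, TranslateQuotient.mk_smul, hxy]

/-- The starting point for Zorn's lemma: with no functions all points are identified, and the domain
consists of the constants. -/
theorem exists_isInvariantRegularExtension [Nonempty K] (i : K → Y) :
    ∃ T, IsInvariantRegularExtension G i T := by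
  let x₀ : K := Classical.arbitrary K
  let T : C(K, ℝ) →ₗ.[ℝ] C(Y, ℝ) :=
    ⟨factorSubmodule G ∅,
      { toFun := fun f => (f : C(K, ℝ)) x₀ • 1
        map_add' := fun f f' => by simp [add_smul]
        map_smul' := fun c f => by simp [mul_smul] }⟩
  have hT : ∀ f, T f = (f : C(K, ℝ)) x₀ • 1 := fun _ => rfl
  refine ⟨T, IsPartialRegularExtension.isInvariantRegularExtension (F := ∅)
    ⟨fun _ _ _ => rfl, ?_, fun f hf y => ?_, fun f k => ?_⟩ rfl⟩
  · rw [hT]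
    simp
  · rw [hT]
    simpa using hf x₀
  · rw [hT]
    have := f.2 x₀ k (TranslateQuotient.mk_eq_mk.2 (by simp))
    simpa using this

/-- The union of the domains of a chain need not be closed, so it need not be a `factorSubmodule`.
Closure under products and translations does survive the union; this is why Zorn's lemma is applied
to invariant subalgebras. -/
theorem exists_upperBound_isInvariantRegularExtension {i : K → Y}
    {c : Set (C(K, ℝ) →ₗ.[ℝ] C(Y, ℝ))} (hc : ∀ T ∈ c, IsInvariantRegularExtension G i T)
    (hchain : IsChain (· ≤ ·) c) (hne : c.Nonempty) :
    ∃ T, IsInvariantRegularExtension G i T ∧ ∀ T' ∈ c, T' ≤ T := by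
  have hdir : DirectedOn (· ≤ ·) c := hchain.directedOn
  have hmem : ∀ f, f ∈ (LinearPMap.sSup c hdir).domain ↔ ∃ T ∈ c, f ∈ T.domain :=
    fun f => LinearPMap.mem_domain_sSup_iff hne hdir
  have hval : ∀ f : (LinearPMap.sSup c hdir).domain, ∃ T ∈ c, ∃ f' : T.domain,
      (f' : C(K, ℝ)) = f ∧ LinearPMap.sSup c hdir f = T f' := by
    intro f
    obtain ⟨T, hT, hf⟩ := (hmem f).1 f.2
    exact ⟨T, hT, ⟨f, hf⟩, rfl, ((LinearPMap.le_sSup hdir hT).2 rfl).symm⟩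
  obtain ⟨T₀, hT₀⟩ := hne
  have hone : (1 : C(K, ℝ)) ∈ (LinearPMap.sSup c hdir).domain :=
    (hmem 1).2 ⟨T₀, hT₀, (hc _ hT₀).regular.one_mem⟩
  refine ⟨LinearPMap.sSup c hdir, ⟨⟨hone, ?_, ?_, ?_⟩, ?_, ?_⟩,
    fun T' hT' => LinearPMap.le_sSup hdir hT'⟩
  · obtain ⟨T, hT, f', hf', h⟩ := hval ⟨1, hone⟩
    rw [h, ← (hc T hT).regular.map_one]
    exact congr_arg _ (Subtype.ext hf')
  · intro f hf
    obtain ⟨T, hT, f', hf', h⟩ := hval f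
    rw [h]
    exact (hc T hT).regular.nonneg f' (hf' ▸ hf)
  · intro f k
    obtain ⟨T, hT, f', hf', h⟩ := hval f
    rw [h, (hc T hT).regular.apply_apply, hf']
  · intro f hf f' hf'
    obtain ⟨T, hT, h⟩ := (hmem f).1 hf
    obtain ⟨T', hT', h'⟩ := (hmem f').1 hf'
    obtain ⟨T'', hT'', hle, hle'⟩ := hdir T hT T' hT'
    exact (hmem _).2 ⟨T'', hT'', (hc _ hT'').mul_mem _ (hle.1 h) _ (hle'.1 h')⟩
  · intro g f hf
    obtain ⟨T, hT, h⟩ := (hmem f).1 hf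
    exact (hmem _).2 ⟨T, hT, (hc _ hT).comp_mem g f h⟩

/-- A compact space with orbit uniform functions and open quotient maps is Dugundji. -/
theorem isDugundji_of_isOpenMap_mk [TopologicalSpace G] [CompactSpace K] [T2Space K] [Nonempty K] (hG : IsOmegaNarrow G)
    (hu : ∀ f : C(K, ℝ), IsOrbitUniform G f)
    (ho : ∀ F : Set C(K, ℝ), IsOpenMap (TranslateQuotient.mk G F)) : IsDugundji K := by
  refine ⟨inferInstance, inferInstance, fun Y _ _ _ i hi => ?_⟩
  obtain ⟨T₀, hT₀⟩ := exists_isInvariantRegularExtension (G := G) i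
  obtain ⟨T, -, hT⟩ := zorn_le_nonempty₀ {T | IsInvariantRegularExtension G i T}
    (fun c hc hchain T hTc => exists_upperBound_isInvariantRegularExtension hc hchain ⟨T, hTc⟩)
    T₀ hT₀
  have hTi : IsInvariantRegularExtension G i T := hT.prop
  have htop : T.domain = ⊤ := by
    refine eq_top_iff.2 fun f _ => ?_
    -- By Stone–Weierstrass the closure of the maximal domain is a `factorSubmodule`; adjoining `f`
    -- to it must then stay inside the maximal domain.
    obtain ⟨T₁, hTT₁, hT₁d, hT₁⟩ := hTi.regular.exists_extension_closure
    let B : Subalgebra ℝ C(K, ℝ) :=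
      T.domain.toSubalgebra hTi.regular.one_mem fun f f' hf hf' => hTi.mul_mem f hf f' hf'
    have hB : (Subalgebra.toSubmodule B) = T.domain := Submodule.toSubalgebra_toSubmodule _ _ _
    have h1 := B.topologicalClosure_eq_factorSubmodule (G := G) hTi.comp_mem
    rw [hB] at h1
    obtain ⟨T₂, hT₁₂, hT₂d, hT₂⟩ := exists_partialRegularExtension_insert hG hi (ho B) hT₁
      (hT₁d.trans h1) (hu f)
    have h2 : T₂ ≤ T := hT.le_of_ge (hT₂.isInvariantRegularExtension hT₂d) (hTT₁.trans hT₁₂)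
    refine h2.1 ?_
    rw [hT₂d]
    exact subset_factorSubmodule (mem_insert _ _)
  let E : C(K, ℝ) →ₗ[ℝ] C(Y, ℝ) :=
    T.toFun ∘ₗ (LinearMap.id.codRestrict T.domain fun f => htop ▸ Submodule.mem_top)
  exact ⟨E, hTi.regular.map_one, fun f hf => hTi.regular.nonneg _ hf,
    fun f k => hTi.regular.apply_apply _ k⟩

theorem IsAlmostTransitive.isDugundji [TopologicalSpace G] [IsTopologicalGroup G]
    [CompactSpace K] [T2Space K] (hG : IsOmegaNarrow G)
    {x₀ : K} (h : IsAlmostTransitive G x₀) : IsDugundji K :=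
  have : Nonempty K := ⟨x₀⟩
  isDugundji_of_isOpenMap_mk hG h.orbitUniform (h.isOpenMap_mk hG)

end Zorn

/-! ### The countable chain condition -/

section CCC

open MeasureTheory in
theorem volume_pos_of_isOpen_unitInterval {U : Set unitInterval} (hU : IsOpen U)
    (hne : U.Nonempty) : 0 < volume U := by
  obtain ⟨V, hV, rfl⟩ := isOpen_induced_iff.1 hU
  obtain ⟨x, hx⟩ := hne
  rw [unitInterval.volume_apply, Subtype.image_preimage_coe]
  have h1 : (V ∩ Ioo (0 : ℝ) 1).Nonempty := by
    refine mem_closure_iff.1 ?_ V hV hx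
    rw [closure_Ioo zero_ne_one]
    exact x.2
  refine ((hV.inter isOpen_Ioo).measure_pos volume h1).trans_le (measure_mono ?_)
  exact fun y hy => ⟨Ioo_subset_Icc_self hy.2, hy.1⟩

open MeasureTheory in
/-- Tychonoff cubes satisfy the countable chain condition. -/
theorem countable_of_pairwise_disjoint_isOpen_cube {I A : Type*} {O : A → Set (I → unitInterval)}
    (ho : ∀ a, IsOpen (O a)) (hne : ∀ a, (O a).Nonempty)
    (hd : Pairwise (Function.onFun Disjoint O)) : Countable A := by
  choose x hx using hne
  choose s t ht hst using fun a => isOpen_pi_iff.1 (ho a) (x a) (hx a)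
  have hmeas : ∀ a, ∀ i ∈ s a, MeasurableSet (t a i) := fun a i hi => (ht a i hi).1.measurableSet
  -- The product of Lebesgue measures is positive on nonempty open boxes, and a probability measure
  -- allows only countably many disjoint sets of positive measure.
  let μ : Measure (I → unitInterval) := Measure.infinitePi fun _ => volume
  have hpos : ∀ a, 0 < μ ((s a : Set I).pi (t a)) := by
    intro a
    rw [Measure.infinitePi_pi _ (hmeas a), pos_iff_ne_zero, Finset.prod_ne_zero_iff]
    intro i hi
    exact (volume_pos_of_isOpen_unitInterval (ht a i hi).1 ⟨x a i, (ht a i hi).2⟩).ne'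
  have hc := Measure.countable_meas_pos_of_disjoint_iUnion (μ := μ)
    (As := fun a => (s a : Set I).pi (t a))
    (fun a => MeasurableSet.pi (s a).countable_toSet (hmeas a))
    fun a b hab => (hd hab).mono (hst a) (hst b)
  simp only [hpos, ofPred_true] at hc
  exact countable_univ_iff.1 hc

/-- Dugundji spaces satisfy the countable chain condition. -/
theorem IsDugundji.countable_of_pairwise_disjoint_isOpen {K : Type u} [TopologicalSpace K]
    (hK : IsDugundji K) {A : Type*} {O : A → Set K} (ho : ∀ a, IsOpen (O a))
    (hne : ∀ a, (O a).Nonempty) (hd : Pairwise (Function.onFun Disjoint O)) : Countable A := by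
  obtain ⟨_, _, hE⟩ := hK
  let i : K → (C(K, unitInterval) → unitInterval) := fun k f => f k
  have hi : IsEmbedding i := by
    refine (Continuous.isClosedEmbedding (by fun_prop) fun k k' hkk' => ?_).isEmbedding
    by_contra hne
    obtain ⟨f, hf0, hf1, hf⟩ := exists_continuous_zero_one_of_isClosed
      (isClosed_singleton (x := k)) (isClosed_singleton (x := k')) (by simpa using hne)
    have h1 := congr_arg Subtype.val (congr_fun hkk' ⟨fun k => ⟨f k, hf k⟩, by fun_prop⟩)
    have h2 : f k = f k' := h1
    rw [hf0 rfl, hf1 rfl] at h2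
    exact zero_ne_one h2
  obtain ⟨E, hE1, hE0, hEi⟩ := hE _ i hi
  choose k hk using hne
  choose f hf0 hf1 hf using fun a => exists_continuous_zero_one_of_isClosed
    (ho a).isClosed_compl (isClosed_singleton (x := k a)) (by simpa using hk a)
  -- Disjoint supports give `f a + f b ≤ 1`, hence `E (f a) + E (f b) ≤ 1`: the two cannot both
  -- exceed `1 / 2` at one point of the cube.
  refine countable_of_pairwise_disjoint_isOpen_cube (O := fun a => {y | 1 / 2 < E (f a) y})
    (fun a => isOpen_lt continuous_const (E (f a)).continuous) (fun a => ⟨i (k a), ?_⟩) ?_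
  · rw [mem_ofPred_eq, hEi, hf1 a rfl]
    norm_num
  · intro a b hab
    refine Set.disjoint_left.2 fun y hya hyb => ?_
    have h1 := hE0 (1 - f a - f b) fun z => by
      change 0 ≤ 1 - f a z - f b z
      by_cases hz : z ∈ O a
      · have h2 : f b z = 0 := hf0 b fun hz' => Set.disjoint_left.1 (hd hab) hz hz'
        have := (hf a z).2
        linarith
      · have h2 : f a z = 0 := hf0 a hz
        have := (hf b z).2
        linarith
    rw [map_sub, map_sub, hE1] at h1
    have h2 : 0 ≤ 1 - E (f a) y - E (f b) y := h1 y
    have h3 : 1 / 2 < E (f a) y := hya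
    have h4 : 1 / 2 < E (f b) y := hyb
    linarith

end CCC

/-! ### Extending bounded functions from a `Gδ`-dense orbit -/

section Extend

variable {G : Type v} [Group G] [TopologicalSpace G] [IsTopologicalGroup G] {K : Type u}
  [TopologicalSpace K] [CompactSpace K] [T2Space K] [MulAction G K] [ContinuousConstSMul G K]
  {x₀ : K}

/-- The closure of an open set in an almost transitive compact space is determined by countably
many functions. -/
theorem IsAlmostTransitive.exists_countable_closure (hG : IsOmegaNarrow G)
    (h : IsAlmostTransitive G x₀) {O : Set K} (hO : IsOpen O) :
    ∃ F : Set C(K, ℝ), F.Countable ∧ ∀ F', F ⊆ F' → F'.Countable → ∀ z z',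
      TranslateQuotient.mk G F' z = TranslateQuotient.mk G F' z' → z ∈ closure O →
        z' ∈ closure O := by
  let coz : C(K, ℝ) → Set K := fun φ => Function.support φ
  have hcoz : ∀ φ, IsOpen (coz φ) := fun φ => φ.continuous.isOpen_support
  -- A maximal disjoint family of nonempty cozero sets inside `O` is countable by the chain
  -- condition, and its union is dense in `O` by maximality.
  obtain ⟨F, hF⟩ := zorn_subset
    {F : Set C(K, ℝ) | (∀ φ ∈ F, (coz φ).Nonempty ∧ coz φ ⊆ O) ∧ F.PairwiseDisjoint coz} (by
      intro c hc hchain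
      refine ⟨⋃₀ c, ⟨?_, ?_⟩, fun s hs => subset_sUnion_of_mem hs⟩
      · rintro φ ⟨s, hs, hφ⟩
        exact (hc hs).1 φ hφ
      · exact (pairwiseDisjoint_sUnion hchain.directedOn).2 fun s hs => (hc hs).2)
  obtain ⟨hF1, hF2⟩ := hF.prop
  have hFc : F.Countable :=
    (h.isDugundji hG).countable_of_pairwise_disjoint_isOpen (A := F) (O := fun φ => coz φ)
      (fun φ => hcoz _) (fun φ => (hF1 φ φ.2).1)
      fun φ ψ hφψ => hF2 φ.2 ψ.2 fun h => hφψ (Subtype.ext h)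
  have hcl : O ⊆ closure (⋃ φ ∈ F, coz φ) := by
    intro x hx
    by_contra hxc
    obtain ⟨f, hf0, hf1, -⟩ := exists_continuous_zero_one_of_isClosed
      ((hO.inter (isOpen_compl_iff.2 (isClosed_closure
        (s := ⋃ φ ∈ F, coz φ)))).isClosed_compl)
      (isClosed_singleton (x := x)) (disjoint_singleton_right.2 fun h => h ⟨hx, hxc⟩)
    have hsub : coz f ⊆ O ∩ (closure (⋃ φ ∈ F, coz φ))ᶜ := by
      intro y hy
      by_contra hy'
      exact hy (hf0 hy')
    have hxf : x ∈ coz f := by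
      change f x ≠ 0
      rw [hf1 rfl]
      exact one_ne_zero
    have hdis : ∀ φ ∈ F, Disjoint (coz f) (coz φ) := fun φ hφ =>
      Set.disjoint_left.2 fun y hy hy' =>
        (hsub hy).2 (subset_closure (mem_biUnion hφ hy'))
    have hins : insert f F ⊆ F := hF.le_of_ge (y := insert f F) ⟨?_, ?_⟩ (subset_insert f F)
    · have hfF := hins (mem_insert f F)
      exact (hsub hxf).2 (subset_closure (mem_biUnion hfF hxf))
    · rintro φ (rfl | hφ)
      · exact ⟨⟨x, hxf⟩, hsub.trans inter_subset_left⟩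
      · exact hF1 φ hφ
    · exact hF2.insert fun φ hφ _ => hdis φ hφ
  have hclO : closure O = closure (⋃ φ ∈ F, coz φ) :=
    le_antisymm (closure_minimal hcl isClosed_closure)
      (closure_mono (iUnion₂_subset fun φ hφ => (hF1 φ hφ).2))
  refine ⟨F, hFc, fun F' hFF' hF' z z' hzz' hz => ?_⟩
  rw [hclO] at hz ⊢
  have hopen := h.isOpenMap_mk_of_countable hG hF'
  refine mem_closure_iff.2 fun N hN hz'N => ?_
  -- Since the quotient map is open, the saturation of `N` is a neighbourhood of `z`, so it meets
  -- the cozero sets; these are saturated.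
  obtain ⟨w, ⟨n, hn, hnw⟩, hw⟩ := mem_closure_iff.1 hz _
    ((hopen N hN).preimage TranslateQuotient.continuous_mk) ⟨z', hz'N, hzz'.symm⟩
  obtain ⟨φ, hφ, hwφ⟩ := mem_iUnion₂.1 hw
  refine ⟨n, hn, mem_biUnion hφ ?_⟩
  have := TranslateQuotient.mk_eq_mk.1 hnw φ (hFF' hφ) 1
  rw [one_smul, one_smul] at this
  change φ n ≠ 0
  rw [this]
  exact hwφ

/-- The orbit of a point with `Gδ`-dense orbit is `C*`-embedded. -/
theorem IsAlmostTransitive.exists_extension (hG : IsOmegaNarrow G) (h : IsAlmostTransitive G x₀)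
    {X : Type*} [TopologicalSpace X] {j : X → K} (hj : IsDenseInducing j)
    (hjx : ∀ g : G, g • x₀ ∈ range j) (f : C(X, ℝ)) {C : ℝ} (hC : ∀ x, |f x| ≤ C) :
    ∃ f' : C(K, ℝ), ∀ x, f' (j x) = f x := by
  have key : ∀ r s : ℝ, r < s → Disjoint (closure (j '' {x | f x < r})) (closure (j '' {x | s < f x})) := by
    intro r s hrs
    obtain ⟨O₁, hO₁, hO₁'⟩ := hj.isInducing.isOpen_iff.1
      (isOpen_lt f.continuous continuous_const : IsOpen {x | f x < r})
    obtain ⟨O₂, hO₂, hO₂'⟩ := hj.isInducing.isOpen_iff.1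
      (isOpen_lt continuous_const f.continuous : IsOpen {x | s < f x})
    obtain ⟨F₁, hF₁c, hF₁⟩ := h.exists_countable_closure hG hO₁
    obtain ⟨F₂, hF₂c, hF₂⟩ := h.exists_countable_closure hG hO₂
    have hc := hF₁c.union hF₂c
    rw [← hO₁', ← hO₂']
    refine Set.disjoint_left.2 fun z hz₁ hz₂ => ?_
    have hz₁ := closure_mono (image_preimage_subset j O₁) hz₁
    have hz₂ := closure_mono (image_preimage_subset j O₂) hz₂
    have := h.isPretransitive_of_countable hG hc
    -- Some orbit point `j x` has the same class as `z` and hence lies in both closures; there `f x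
    -- ≤ r` and `s ≤ f x` contradict each other.
    obtain ⟨g, hg⟩ := MulAction.exists_smul_eq G (TranslateQuotient.mk G (F₁ ∪ F₂) x₀)
      (TranslateQuotient.mk G (F₁ ∪ F₂) z)
    obtain ⟨x, hx⟩ := hjx g
    rw [← TranslateQuotient.mk_smul, ← hx] at hg
    have h1 := hF₁ _ subset_union_left hc z (j x) hg.symm hz₁
    have h2 := hF₂ _ subset_union_right hc z (j x) hg.symm hz₂
    have h3 : f x ≤ r := by
      have : x ∈ closure {x | f x < r} := by
        rw [hj.isInducing.closure_eq_preimage_closure_image, ← hO₁', image_preimage_eq_inter_range,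
          mem_preimage]
        exact closure_minimal (Dense.open_subset_closure_inter hj.dense hO₁) isClosed_closure h1
      exact closure_minimal (fun y hy => le_of_lt hy)
        (isClosed_le f.continuous continuous_const) this
    have h4 : s ≤ f x := by
      have : x ∈ closure {x | s < f x} := by
        rw [hj.isInducing.closure_eq_preimage_closure_image, ← hO₂', image_preimage_eq_inter_range,
          mem_preimage]
        exact closure_minimal (Dense.open_subset_closure_inter hj.dense hO₂) isClosed_closure h2
      exact closure_minimal (fun y hy => le_of_lt hy)
        (isClosed_le continuous_const f.continuous) this
    linarith
  have hext : Continuous (hj.extend f) := by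
    refine hj.continuous_extend fun b => ?_
    have hne : (comap j (𝓝 b)).NeBot := hj.comap_nhds_neBot b
    have hmem : Icc (-C) C ∈ map f (comap j (𝓝 b)) :=
      mem_map.2 (univ_mem' fun x => abs_le.1 (hC x))
    -- Boundedness gives a cluster value of `f` at `b`; by `key` there cannot be two.
    obtain ⟨c, hc, hcl⟩ := isCompact_Icc.exists_clusterPt (le_principal_iff.2 hmem)
    have hcluster : ∀ {c : ℝ} {U : Set ℝ}, ClusterPt c (map f (comap j (𝓝 b))) → U ∈ 𝓝 c →
        b ∈ closure (j '' (f ⁻¹' U)) := by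
      intro c U hc hU
      refine mem_closure_iff_nhds.2 fun W hW => ?_
      have h1 : f '' (j ⁻¹' W) ∈ map f (comap j (𝓝 b)) :=
        image_mem_map (preimage_mem_comap hW)
      obtain ⟨_, hyU, x, hx, rfl⟩ := clusterPt_iff_nonempty.1 hc hU h1
      exact ⟨j x, hx, x, hyU, rfl⟩
    have hlt : ∀ {c c' : ℝ}, ClusterPt c (map f (comap j (𝓝 b))) →
        ClusterPt c' (map f (comap j (𝓝 b))) → ¬ c < c' := by
      intro c c' h h' hcc'
      obtain ⟨r, hcr, hrc'⟩ := exists_between hcc'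
      obtain ⟨s, hrs, hsc'⟩ := exists_between hrc'
      exact Set.disjoint_left.1 (key r s hrs) (hcluster h (Iio_mem_nhds hcr))
        (hcluster h' (Ioi_mem_nhds hsc'))
    refine ⟨c, isCompact_Icc.le_nhds_of_unique_clusterPt hmem fun c' _ hc' => ?_⟩
    exact le_antisymm (not_lt.1 (hlt hcl hc')) (not_lt.1 (hlt hc' hcl))
  exact ⟨⟨_, hext⟩, fun x => hj.extend_eq f.continuous x⟩

end Extend

/-! ### Pseudocompact spaces are Baire -/

section Pseudocompact

variable {X : Type u} [TopologicalSpace X] [CompletelyRegularSpace X]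

/-- In a pseudocompact space, a decreasing sequence of nonempty open sets has a common
closure point. -/
theorem nonempty_iInter_closure_of_forall_bounded
    (hX : ∀ f : X → ℝ, Continuous f → ∃ C : ℝ, ∀ x, |f x| ≤ C) {V : ℕ → Set X}
    (ho : ∀ n, IsOpen (V n)) (hne : ∀ n, (V n).Nonempty) (hanti : Antitone V) :
    (⋂ n, closure (V n)).Nonempty := by
  by_contra hempty
  choose x hx using hne
  choose f hfc hf0 hf1 using fun n =>
    CompletelyRegularSpace.completely_regular (x n) _ (ho n).isClosed_compl (by simpa using hx n)
  -- Bumps of height `n` at `x n`, supported in `V n`. If the closures had no common point, the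
  -- supports would be locally finite and the sum continuous but unbounded.
  let φ : ℕ → X → ℝ := fun n y => n * (1 - f n y)
  have hφc : ∀ n, Continuous (φ n) := fun n =>
    continuous_const.mul (continuous_const.sub (continuous_subtype_val.comp (hfc n)))
  have hφ0 : ∀ n y, 0 ≤ φ n y := fun n y =>
    mul_nonneg n.cast_nonneg (sub_nonneg.2 (f n y).2.2)
  have hsupp : ∀ n, Function.support (φ n) ⊆ V n := by
    intro n y hy
    by_contra hyV
    refine hy ?_
    have : f n y = 1 := hf1 n hyV
    simp [φ, this]
  have hlf : LocallyFinite fun n => Function.support (φ n) := by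
    intro y
    have hy : y ∉ ⋂ n, closure (V n) := fun hy => hempty ⟨y, hy⟩
    rw [mem_iInter] at hy
    push Not at hy
    obtain ⟨N, hN⟩ := hy
    refine ⟨(closure (V N))ᶜ, isClosed_closure.isOpen_compl.mem_nhds hN,
      (finite_lt_nat N).subset ?_⟩
    rintro n ⟨z, hz, hzN⟩
    by_contra hn
    exact hzN (subset_closure (hanti (not_lt.1 hn) (hsupp n hz)))
  obtain ⟨C, hC⟩ := hX _ (continuous_finsum hφc hlf)
  obtain ⟨n, hn⟩ := exists_nat_gt C
  have h1 : φ n (x n) ≤ ∑ᶠ i, φ i (x n) :=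
    single_le_finsum n (hlf.point_finite (x n)) fun j => hφ0 j (x n)
  have h2 : φ n (x n) = n := by simp [φ, hf0 n]
  have h3 := (abs_le.1 (hC (x n))).2
  linarith

/-- The nested-sets proof for compact spaces carries over, with the common closure point in place of
compactness. -/
theorem baireSpace_of_forall_bounded
    (hX : ∀ f : X → ℝ, Continuous f → ∃ C : ℝ, ∀ x, |f x| ≤ C) : BaireSpace X where
  baire_property f ho hd := by
    refine dense_iff_inter_open.2 fun U hU hUne => ?_
    have step : ∀ (n : ℕ) (W : {W : Set X // IsOpen W ∧ W.Nonempty}),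
        ∃ W' : {W : Set X // IsOpen W ∧ W.Nonempty}, closure W'.1 ⊆ W.1 ∩ f n := by
      rintro n ⟨W, hW, hWne⟩
      obtain ⟨x, hx⟩ := (hd n).inter_open_nonempty W hW hWne
      obtain ⟨C, hC, hCc, hCs⟩ := exists_mem_nhds_isClosed_subset ((hW.inter (ho n)).mem_nhds hx)
      exact ⟨⟨interior C, isOpen_interior, ⟨x, mem_interior_iff_mem_nhds.2 hC⟩⟩,
        (closure_minimal interior_subset hCc).trans hCs⟩
    choose next hnext using step
    let W : ℕ → {W : Set X // IsOpen W ∧ W.Nonempty} := fun n => Nat.rec ⟨U, hU, hUne⟩ next n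
    have hW : ∀ n, closure (W (n + 1)).1 ⊆ (W n).1 ∩ f n := fun n => hnext n (W n)
    obtain ⟨z, hz⟩ := nonempty_iInter_closure_of_forall_bounded hX (fun n => (W n).2.1)
      (fun n => (W n).2.2) (antitone_nat_of_succ_le fun n =>
        subset_closure.trans ((hW n).trans inter_subset_left))
    rw [mem_iInter] at hz
    exact ⟨z, (hW 0 (hz 1)).1, mem_iInter.2 fun n => (hW n (hz (n + 1))).2⟩

end Pseudocompact

/-! ### The orbit uniformity and its total boundedness -/

section OrbitUniformity

variable {G : Type v} [Group G] [TopologicalSpace G] [IsTopologicalGroup G]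

theorem exists_nhds_one_conj_subset (g : G) {U : Set G} (hU : U ∈ 𝓝 (1 : G)) :
    ∃ V ∈ 𝓝 (1 : G), ∀ v ∈ V, g * v * g⁻¹ ∈ U := by
  have h : Continuous fun v : G => g * v * g⁻¹ := by fun_prop
  exact ⟨_, h.continuousAt.preimage_mem_nhds (by simpa using hU), fun v hv => hv⟩

/-- An action with nearly open orbit maps gives rise to a uniformity compatible with the
topology. -/
theorem exists_uniformSpace_of_closure_orbit_mem_nhds {X : Type u} [t : TopologicalSpace X]
    [RegularSpace X] [MulAction G X] [ContinuousConstSMul G X]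
    (ho : ∀ x : X, ContinuousAt (fun g : G => g • x) 1)
    (hn : ∀ U ∈ 𝓝 (1 : G), ∀ x : X, closure ((fun g : G => g • x) '' U) ∈ 𝓝 x) :
    ∃ u : UniformSpace X, u.toTopologicalSpace = t ∧
      (∀ U ∈ 𝓝 (1 : G), {p : X × X | p.2 ∈ closure ((fun g : G => g • p.1) '' U)} ∈ 𝓤 X) ∧
      ∀ s ∈ 𝓤 X, ∃ U ∈ 𝓝 (1 : G),
        {p : X × X | p.2 ∈ closure ((fun g : G => g • p.1) '' U)} ⊆ s := by
  let E : Set G → Set (X × X) := fun U => {p | p.2 ∈ closure ((fun g : G => g • p.1) '' U)}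
  have hE : ∀ {U V}, U ⊆ V → E U ⊆ E V := fun h p hp => closure_mono (image_mono h) hp
  let B : FilterBasis (X × X) :=
    { sets := E '' {U | U ∈ 𝓝 (1 : G)}
      nonempty := ⟨_, univ, univ_mem, rfl⟩
      inter_sets := by
        rintro _ _ ⟨U, hU, rfl⟩ ⟨V, hV, rfl⟩
        exact ⟨_, ⟨U ∩ V, inter_mem hU hV, rfl⟩,
          subset_inter (hE inter_subset_left) (hE inter_subset_right)⟩ }
  have hcl : ∀ (g : G) (S : Set X) (x : X), x ∈ closure S →
      g • x ∈ closure ((fun x => g • x) '' S) := fun g S x hx =>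
    image_closure_subset_closure_image (continuous_const_smul g) ⟨x, hx, rfl⟩
  let c : UniformSpace.Core X := UniformSpace.Core.mkOfBasis B
    (by
      rintro _ ⟨U, hU, rfl⟩ x
      exact subset_closure ⟨1, mem_of_mem_nhds hU, one_smul _ _⟩)
    (by
      rintro _ ⟨U, hU, rfl⟩
      obtain ⟨V, hV, hVU⟩ := exists_nhds_one_inv_mul_subset hU
      refine ⟨_, ⟨V, hV, rfl⟩, ?_⟩
      rintro ⟨x, y⟩ hxy
      -- Symmetry uses near openness: `closure (V • y)` is a neighbourhood of `y`, so it contains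
      -- some `v • x`, and `v⁻¹` brings this back to `x`.
      obtain ⟨_, hz, v, hv, rfl⟩ := mem_closure_iff_nhds.1 hxy _ (hn V hV y)
      have h1 := hcl v⁻¹ _ _ hz
      simp only [inv_smul_smul] at h1
      refine closure_mono ?_ h1
      rintro _ ⟨_, ⟨w, hw, rfl⟩, rfl⟩
      exact ⟨v⁻¹ * w, hVU v hv w hw, by simp [mul_smul]⟩)
    (by
      rintro _ ⟨U, hU, rfl⟩
      obtain ⟨V, hV, hVU⟩ := exists_nhds_one_split hU
      refine ⟨_, ⟨V, hV, rfl⟩, ?_⟩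
      rintro ⟨x, z⟩ ⟨y, hxy, hyz⟩
      refine closure_minimal ?_ isClosed_closure hyz
      rintro _ ⟨v, hv, rfl⟩
      refine closure_mono ?_ (hcl v _ _ hxy)
      rintro _ ⟨_, ⟨w, hw, rfl⟩, rfl⟩
      exact ⟨v * w, hVU v hv w hw, by simp [mul_smul]⟩)
  have hc : ∀ s, s ∈ c.uniformity ↔ ∃ U ∈ 𝓝 (1 : G), E U ⊆ s := by
    intro s
    refine FilterBasis.mem_filter_iff (B := B) |>.trans ?_
    constructor
    · rintro ⟨_, ⟨U, hU, rfl⟩, h⟩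
      exact ⟨U, hU, h⟩
    · rintro ⟨U, hU, h⟩
      exact ⟨_, ⟨U, hU, rfl⟩, h⟩
  have hnhds : ∀ x, 𝓝 x = comap (Prod.mk x) c.uniformity := by
    intro x
    ext W
    rw [mem_comap]
    constructor
    · intro hW
      obtain ⟨C, hC, hCc, hCW⟩ := exists_mem_nhds_isClosed_subset hW
      refine ⟨E ((fun g : G => g • x) ⁻¹' C), (hc _).2 ⟨_, ?_, subset_rfl⟩, fun y hy => hCW ?_⟩
      · exact (ho x).preimage_mem_nhds (by simpa using hC)
      · exact closure_minimal (image_preimage_subset _ _) hCc hy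
    · rintro ⟨s, hs, hsW⟩
      obtain ⟨U, hU, hUs⟩ := (hc s).1 hs
      exact mem_of_superset (hn U hU x) fun y hy => hsW (hUs hy)
  exact ⟨{ toTopologicalSpace := t, uniformity := c.uniformity, symm := c.symm, comp := c.comp,
           nhds_eq_comap_uniformity := hnhds }, rfl, fun U hU => (hc _).2 ⟨U, hU, subset_rfl⟩,
    fun s hs => (hc s).1 hs⟩

/-- By ω-narrowness, countably many sets `closure (V • a n • x₀)` have interiors covering `X`. If no
finite union were everything, the complements of the finite unions would have a common closure
point, which no such interior can contain. -/
theorem totallyBounded_univ_of_closure_orbit (hG : IsOmegaNarrow G) {X : Type u} [UniformSpace X]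
    (hX : ∀ f : X → ℝ, Continuous f → ∃ C : ℝ, ∀ x, |f x| ≤ C) [Nonempty X]
    [MulAction G X] [MulAction.IsPretransitive G X]
    (hn : ∀ U ∈ 𝓝 (1 : G), ∀ x : X, closure ((fun g : G => g • x) '' U) ∈ 𝓝 x)
    (hs : ∀ s ∈ 𝓤 X, ∃ U ∈ 𝓝 (1 : G),
        {p : X × X | p.2 ∈ closure ((fun g : G => g • p.1) '' U)} ⊆ s) :
    TotallyBounded (univ : Set X) := by
  intro s hsX
  obtain ⟨U, hU, hUs⟩ := hs _ (symm_le_uniformity hsX)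
  obtain ⟨V, hVU, hV, hV1⟩ := mem_nhds_iff.1 hU
  obtain ⟨A, hA, hVA⟩ := hG.exists_right (hV.mem_nhds hV1)
  have hAne : A.Nonempty := by
    obtain ⟨-, -, a, ha, -⟩ := hVA 1
    exact ⟨a, ha⟩
  obtain ⟨a, rfl⟩ := hA.exists_eq_range hAne
  let x₀ : X := Classical.arbitrary X
  let C : ℕ → Set X := fun n => closure ((fun g : G => g • a n • x₀) '' V)
  have hcov : ∀ x, ∃ n, x ∈ interior (C n) := by
    intro x
    obtain ⟨g, rfl⟩ := MulAction.exists_smul_eq G x₀ x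
    obtain ⟨v, hv, _, ⟨n, rfl⟩, rfl⟩ := hVA g
    refine ⟨n, mem_interior_iff_mem_nhds.2 ?_⟩
    have h1 : (fun w : G => w * v) ⁻¹' V ∈ 𝓝 (1 : G) :=
      (hV.preimage (continuous_mul_const v)).mem_nhds (by simpa using hv)
    refine mem_of_superset (hn _ h1 ((v * a n) • x₀)) (closure_mono ?_)
    rintro _ ⟨w, hw, rfl⟩
    exact ⟨w * v, hw, by simp [mul_smul]⟩
  have hfin : ∃ N, ⋃ n ∈ Finset.range N, C n = univ := by
    by_contra hcon
    push Not at hcon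
    have hclosed : ∀ N, IsClosed (⋃ n ∈ Finset.range N, C n) := fun N =>
      isClosed_biUnion_finset fun n _ => isClosed_closure
    obtain ⟨z, hz⟩ := nonempty_iInter_closure_of_forall_bounded hX
      (V := fun N => (⋃ n ∈ Finset.range N, C n)ᶜ) (fun N => (hclosed N).isOpen_compl)
      (fun N => nonempty_compl.2 (hcon N)) (fun M N hMN => compl_subset_compl.2
        (biUnion_subset_biUnion_left fun n hn => Finset.range_mono hMN hn))
    obtain ⟨n, hzn⟩ := hcov z
    obtain ⟨w, hw, hw'⟩ := mem_closure_iff.1 (mem_iInter.1 hz (n + 1)) _ isOpen_interior hzn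
    exact hw' (mem_biUnion (Finset.self_mem_range_succ n) (interior_subset hw))
  obtain ⟨N, hN⟩ := hfin
  refine ⟨(fun n => a n • x₀) '' (Finset.range N : Set ℕ), (Finset.finite_toSet _).image _,
    fun x _ => ?_⟩
  obtain ⟨n, hn, hx⟩ := mem_iUnion₂.1 (hN.ge (mem_univ x))
  refine mem_biUnion (mem_image_of_mem _ hn) ?_
  exact hUs (a := (a n • x₀, x)) (closure_mono (image_mono hVU) hx)

end OrbitUniformity

/-! ### The completion, and its identification with `βX` -/

section Completion

variable {G : Type v} [Group G] [TopologicalSpace G]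

open UniformSpace in
/-- The completion of a totally bounded pseudocompact space with a transitive action. -/
theorem isAlmostTransitive_completion {X : Type u} [UniformSpace X]
    (hX : ∀ f : X → ℝ, Continuous f → ∃ C : ℝ, ∀ x, |f x| ≤ C)
    [MulAction G X] [MulAction.IsPretransitive G X] [UniformContinuousConstSMul G X]
    [CompactSpace (Completion X)]
    (hs : ∀ s ∈ 𝓤 X, ∃ U ∈ 𝓝 (1 : G), ∀ u ∈ U, ∀ x : X, (x, u • x) ∈ s) (x₀ : X) :
    IsAlmostTransitive G (x₀ : Completion X) where
  orbitUniform f ε hε := by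
    have hf : UniformContinuous fun x : X => f x :=
      (CompactSpace.uniformContinuous_of_continuous f.continuous).comp
        (Completion.uniformContinuous_coe X)
    obtain ⟨U, hU, h⟩ := hs _ (hf (Metric.dist_mem_uniformity hε))
    refine ⟨U, hU, fun u hu z => ?_⟩
    induction z using Completion.induction_on with
    | hp =>
      exact isClosed_le (((f.continuous.comp (continuous_const_smul u)).sub f.continuous).abs)
        continuous_const
    | ih x =>
      rw [← Completion.coe_smul, ← Real.dist_eq, dist_comm]
      exact (show dist (f x) (f ((u • x : X) : Completion X)) < ε from h u hu x).le
  exists_smul S hS z := by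
    rcases S.eq_empty_or_nonempty with rfl | hSne
    · exact ⟨1, by simp⟩
    obtain ⟨f, rfl⟩ := hS.exists_eq_range hSne
    -- The sum of the `t n` vanishes exactly where every `f n` takes its value at `z`. If it were
    -- positive on `X`, its reciprocal would be bounded there, so by density the sum would be
    -- bounded away from `0` everywhere, including at `z`.
    let t : ℕ → Completion X → ℝ := fun n y => (1 / 2) ^ n * min 1 |f n y - f n z|
    have ht0 : ∀ n y, 0 ≤ t n y := fun n y => by positivity
    have ht1 : ∀ n y, t n y ≤ (1 / 2) ^ n := fun n y =>
      mul_le_of_le_one_right (by positivity) (min_le_left _ _)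
    have htc : ∀ n, Continuous (t n) := fun n => by fun_prop
    have hsum : ∀ y, Summable fun n => t n y := fun y =>
      Summable.of_nonneg_of_le (ht0 · y) (ht1 · y) summable_geometric_two
    have hc : Continuous fun y => ∑' n, t n y :=
      continuous_tsum htc summable_geometric_two fun n y => by
        rw [Real.norm_of_nonneg (ht0 n y)]
        exact ht1 n y
    by_contra hcon
    have hpos : ∀ x : X, 0 < ∑' n, t n x := by
      intro x
      refine lt_of_le_of_ne (tsum_nonneg (ht0 · _)) fun h0 => hcon ?_
      obtain ⟨g, hg⟩ := MulAction.exists_smul_eq G x₀ x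
      refine ⟨g, ?_⟩
      rintro _ ⟨n, rfl⟩
      have h1 := congr_fun ((hasSum_zero_iff_of_nonneg (ht0 · (x : Completion X))).1
        (h0 ▸ (hsum x).hasSum)) n
      have h2 : min 1 |f n x - f n z| = 0 := by
        rcases mul_eq_zero.1 h1 with h | h
        · exact absurd h (by positivity)
        · exact h
      have h3 : |f n x - f n z| = 0 := by
        rcases min_choice (1 : ℝ) |f n x - f n z| with h | h
        · rw [h] at h2
          exact absurd h2 one_ne_zero
        · rw [← h, h2]
      rw [← Completion.coe_smul, hg]
      linarith [abs_eq_zero.1 h3]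
    obtain ⟨C, hC⟩ := hX (fun x => (∑' n, t n x)⁻¹)
      ((hc.comp (Completion.continuous_coe X)).inv₀ fun x => (hpos x).ne')
    have hCpos : 0 < C := (inv_pos.2 (hpos x₀)).trans_le ((le_abs_self _).trans (hC x₀))
    have hle : ∀ y : Completion X, C⁻¹ ≤ ∑' n, t n y := by
      intro y
      induction y using Completion.induction_on with
      | hp => exact isClosed_le continuous_const hc
      | ih x => exact inv_le_of_inv_le₀ (hpos x) ((le_abs_self _).trans (hC x))
    have h0 : ∑' n, t n z = 0 := by simp [t]
    have := hle z
    rw [h0] at this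
    exact absurd (inv_pos.2 hCpos) (not_lt.2 this)

theorem IsDugundji.of_homeomorph {K K' : Type u} [TopologicalSpace K] [TopologicalSpace K']
    (e : K ≃ₜ K') (hK : IsDugundji K) : IsDugundji K' := by
  obtain ⟨_, _, h⟩ := hK
  refine ⟨e.compactSpace, e.t2Space, fun Y _ _ _ i hi => ?_⟩
  obtain ⟨E, hE1, hE0, hE⟩ := h Y (i ∘ e) (hi.comp e.isEmbedding)
  refine ⟨E ∘ₗ (ContinuousMap.compRightAlgHom ℝ ℝ (e : C(K, K'))).toLinearMap, ?_, ?_, ?_⟩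
  · exact hE1
  · exact fun f hf => hE0 _ fun k => hf (e k)
  · intro f k
    have := hE (f.comp (e : C(K, K'))) (e.symm k)
    simpa using this

/-- If all bounded continuous functions extend to a compactification, it is the Stone–Čech
compactification. -/
theorem nonempty_homeomorph_stoneCech {X : Type u} [TopologicalSpace X] {K : Type u}
    [TopologicalSpace K] [CompactSpace K] [T2Space K] {j : X → K} (hj : Continuous j)
    (hjd : DenseRange j)
    (h : ∀ f : C(X, ℝ), (∃ C : ℝ, ∀ x, |f x| ≤ C) → ∃ f' : C(K, ℝ), ∀ x, f' (j x) = f x) :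
    Nonempty (K ≃ₜ StoneCech X) := by
  let φ : StoneCech X → K := stoneCechExtend hj
  have hφ : Continuous φ := continuous_stoneCechExtend hj
  have hφj : ∀ x, φ (stoneCechUnit x) = j x := fun x => stoneCechExtend_stoneCechUnit hj x
  have hsurj : Function.Surjective φ := by
    have h1 : DenseRange φ := hjd.mono (by
      rintro _ ⟨x, rfl⟩
      exact ⟨_, hφj x⟩)
    rw [← range_eq_univ, ← (isCompact_range hφ).isClosed.closure_eq]
    exact h1.closure_range
  have hinj : Function.Injective φ := by
    intro p q hpq
    by_contra hne
    obtain ⟨f, hf0, hf1, hf⟩ := exists_continuous_zero_one_of_isClosed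
      (isClosed_singleton (x := p)) (isClosed_singleton (x := q)) (by simpa using hne)
    obtain ⟨f', hf'⟩ := h (f.comp ⟨_, continuous_stoneCechUnit⟩)
      ⟨1, fun x => abs_le.2 ⟨neg_one_lt_zero.le.trans (hf (stoneCechUnit x)).1,
        (hf (stoneCechUnit x)).2⟩⟩
    have h1 : (f' ∘ φ) = f := by
      refine Continuous.ext_on denseRange_stoneCechUnit (f'.continuous.comp hφ) f.continuous ?_
      rintro _ ⟨x, rfl⟩
      simp only [Function.comp, hφj, hf']
      rfl
    have h2 : f p = f q := by
      rw [← h1]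
      simp only [Function.comp, hpq]
    rw [hf0 rfl, hf1 rfl] at h2
    exact zero_ne_one h2
  exact ⟨(Continuous.homeoOfEquivCompactToT2 (f := Equiv.ofBijective φ ⟨hinj, hsurj⟩) hφ).symm⟩

open UniformSpace in
/-- The Stone–Čech compactification of a pseudocompact space with a transitive action of an
`ω`-narrow group is Dugundji. -/
theorem isDugundji_stoneCech_of_transitive [IsTopologicalGroup G] (hG : IsOmegaNarrow G)
    {X : Type u} [t : TopologicalSpace X] [T35Space X] [Nonempty X]
    (hX : ∀ f : X → ℝ, Continuous f → ∃ C : ℝ, ∀ x, |f x| ≤ C) [MulAction G X]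
    [MulAction.IsPretransitive G X] [ContinuousConstSMul G X]
    (ho : ∀ x : X, Continuous fun g : G => g • x)
    (hn : ∀ U ∈ 𝓝 (1 : G), ∀ x : X, closure ((fun g : G => g • x) '' U) ∈ 𝓝 x) :
    IsDugundji (StoneCech X) := by
  obtain ⟨u, rfl, hu, hus⟩ := exists_uniformSpace_of_closure_orbit_mem_nhds
    (fun x => (ho x).continuousAt) hn
  have htb : TotallyBounded (univ : Set X) := totallyBounded_univ_of_closure_orbit hG hX hn hus
  have hcpt : CompactSpace (Completion X) := by
    have h1 := (htb.image (Completion.uniformContinuous_coe X)).closure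
    rw [image_univ, (Completion.denseRange_coe (α := X)).closure_range] at h1
    exact ⟨h1.isCompact_of_isClosed isClosed_univ⟩
  have huc : UniformContinuousConstSMul G X := by
    refine ⟨fun g s hs => ?_⟩
    obtain ⟨U, hU, hUs⟩ := hus s hs
    -- Translation by `g` carries the entourage of `V` into that of `g * V * g⁻¹`.
    obtain ⟨V, hV, hVU⟩ := exists_nhds_one_conj_subset g hU
    rw [mem_map]
    refine mem_of_superset (hu V hV) ?_
    rintro ⟨x, y⟩ hxy
    refine hUs ?_
    have h1 : g • y ∈ closure ((fun z : X => g • z) '' ((fun g : G => g • x) '' V)) :=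
      image_closure_subset_closure_image (continuous_const_smul g) ⟨y, hxy, rfl⟩
    refine closure_mono ?_ h1
    rintro _ ⟨_, ⟨v, hv, rfl⟩, rfl⟩
    exact ⟨g * v * g⁻¹, hVU v hv, by simp [mul_smul]⟩
  let x₀ : X := Classical.arbitrary X
  have hat : IsAlmostTransitive G (x₀ : Completion X) :=
    isAlmostTransitive_completion hX (fun s hs => by
      obtain ⟨U, hU, hUs⟩ := hus s hs
      exact ⟨U, hU, fun u hu x => hUs (subset_closure ⟨u, hu, rfl⟩)⟩) x₀
  obtain ⟨e⟩ := nonempty_homeomorph_stoneCech (Completion.continuous_coe X)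
    Completion.denseRange_coe fun f ⟨C, hC⟩ =>
      hat.exists_extension hG Completion.isDenseInducing_coe
        (fun g => ⟨g • x₀, Completion.coe_smul g x₀⟩) f hC
  exact (hat.isDugundji hG).of_homeomorph e

end Completion

/-! ### Locally compact spaces and functions vanishing at infinity -/

section LocallyCompact

variable {G : Type v} [Group G] {X : Type u} [TopologicalSpace X] [MulAction G X]

/-- A `σ`-compact homogeneous Baire space is locally compact. -/
theorem weaklyLocallyCompactSpace_of_sigmaCompactSpace [T2Space X] [BaireSpace X]
    [SigmaCompactSpace X] [Nonempty X] [ContinuousConstSMul G X] [MulAction.IsPretransitive G X] :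
    WeaklyLocallyCompactSpace X := by
  obtain ⟨n, y, hy⟩ := nonempty_interior_of_iUnion_of_closed
    (fun n => (isCompact_compactCovering X n).isClosed) (iUnion_compactCovering X)
  refine ⟨fun x => ?_⟩
  obtain ⟨g, rfl⟩ := MulAction.exists_smul_eq G y x
  refine ⟨(fun z => g • z) '' compactCovering X n,
    (isCompact_compactCovering X n).image (continuous_const_smul g), ?_⟩
  exact (isOpenMap_smul g).image_mem_nhds (mem_interior_iff_mem_nhds.1 hy)

theorem isCompact_setOf_le_abs {f : C(X, ℝ)} (hf : Tendsto f (cocompact X) (𝓝 0)) {ε : ℝ}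
    (hε : 0 < ε) : IsCompact {x | ε ≤ |f x|} := by
  obtain ⟨t, ht, hts⟩ := mem_cocompact.1 (hf (Metric.ball_mem_nhds 0 hε))
  refine ht.of_isClosed_subset (isClosed_le continuous_const f.continuous.abs) fun x hx => ?_
  by_contra hxt
  have := hts hxt
  rw [mem_preimage, Metric.mem_ball, Real.dist_0_eq_abs] at this
  exact absurd hx (not_le.2 this)

/-- Functions vanishing at infinity are orbit uniform for continuous actions. -/
theorem isOrbitUniform_of_tendsto_cocompact [TopologicalSpace G] [IsTopologicalGroup G]
    (hcont : Continuous fun p : G × X => p.1 • p.2) {f : C(X, ℝ)}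
    (hf : Tendsto f (cocompact X) (𝓝 0)) : IsOrbitUniform G f := by
  intro ε hε
  have hC := isCompact_setOf_le_abs hf (half_pos hε)
  have key : ∃ U ∈ 𝓝 (1 : G), ∀ u ∈ U, ∀ x ∈ {x | ε / 2 ≤ |f x|}, |f (u • x) - f x| ≤ ε := by
    refine hC.induction_on (p := fun C => ∃ U ∈ 𝓝 (1 : G), ∀ u ∈ U, ∀ x ∈ C,
      |f (u • x) - f x| ≤ ε) ⟨univ, univ_mem, by simp⟩ ?_ ?_ ?_
    · rintro s t hst ⟨U, hU, h⟩
      exact ⟨U, hU, fun u hu x hx => h u hu x (hst hx)⟩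
    · rintro s t ⟨U, hU, h⟩ ⟨V, hV, h'⟩
      refine ⟨U ∩ V, inter_mem hU hV, fun u hu x hx => ?_⟩
      rcases hx with hx | hx
      · exact h u hu.1 x hx
      · exact h' u hu.2 x hx
    · intro x _
      have h1 : Continuous fun p : G × X => |f (p.1 • p.2) - f p.2| := by fun_prop
      have h2 : {p : G × X | |f (p.1 • p.2) - f p.2| < ε} ∈ 𝓝 ((1 : G), x) :=
        h1.continuousAt.preimage_mem_nhds (Iio_mem_nhds (by simpa using hε))
      rw [nhds_prod_eq, mem_prod_iff] at h2
      obtain ⟨U, hU, V, hV, hUV⟩ := h2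
      exact ⟨V, mem_nhdsWithin_of_mem_nhds hV, U, hU, fun u hu y hy =>
        le_of_lt (hUV (mk_mem_prod hu hy))⟩
  obtain ⟨U, hU, h⟩ := key
  -- If only `u • x` lies in the compact set, the estimate is applied to `u⁻¹`; if neither point
  -- does, both values are below `ε / 2`.
  refine ⟨U ∩ U⁻¹, inter_mem hU (inv_mem_nhds_one G hU), fun u hu x => ?_⟩
  by_cases hx : ε / 2 ≤ |f x|
  · exact h u hu.1 x hx
  by_cases hux : ε / 2 ≤ |f (u • x)|
  · have := h u⁻¹ hu.2 (u • x) hux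
    rwa [inv_smul_smul, abs_sub_comm] at this
  · have := abs_sub (f (u • x)) (f x)
    linarith [not_le.1 hx, not_le.1 hux]

/-- A locally compact `σ`-compact space carries a positive function vanishing at infinity. -/
theorem exists_pos_tendsto_cocompact [T2Space X] [LocallyCompactSpace X] [SigmaCompactSpace X] :
    ∃ f : C(X, ℝ), (∀ x, 0 < f x) ∧ Tendsto f (cocompact X) (𝓝 0) := by
  choose χ hχ1 _ hχs hχ using fun n => exists_continuous_one_zero_of_isCompact
    (isCompact_compactCovering X n) isClosed_empty (disjoint_empty _)
  have ht0 : ∀ n x, 0 ≤ (1 / 2 : ℝ) ^ n * χ n x := fun n x => mul_nonneg (by positivity) (hχ n x).1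
  have ht1 : ∀ n x, ‖(1 / 2 : ℝ) ^ n * χ n x‖ ≤ (1 / 2) ^ n := fun n x => by
    rw [Real.norm_of_nonneg (ht0 n x)]
    exact mul_le_of_le_one_right (by positivity) (hχ n x).2
  refine ⟨⟨fun x => ∑' n, (1 / 2 : ℝ) ^ n * χ n x,
    continuous_tsum (fun n => by fun_prop) summable_geometric_two ht1⟩, fun x => ?_, ?_⟩
  · obtain ⟨n, hn⟩ := mem_iUnion.1 ((iUnion_compactCovering X).ge (mem_univ x))
    have hs : Summable fun n => (1 / 2 : ℝ) ^ n * χ n x :=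
      Summable.of_norm_bounded summable_geometric_two (ht1 · x)
    refine hs.tsum_pos (ht0 · x) n ?_
    rw [hχ1 n hn]
    simp
  · have := tendsto_tsum_of_dominated_convergence (𝓕 := cocompact X) (G := ℝ)
      (f := fun x n => (1 / 2 : ℝ) ^ n * χ n x) (g := fun _ => 0) summable_geometric_two
      (fun n => by simpa using (hχs n).is_zero_at_infty.const_mul ((1 / 2 : ℝ) ^ n))
      (Eventually.of_forall fun x n => ht1 n x)
    simpa using this

end LocallyCompact

/-! ### Proper quotient maps -/

namespace TranslateQuotient

variable {G : Type v} [Group G] {X : Type u} [TopologicalSpace X] [MulAction G X]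
  [ContinuousConstSMul G X] {F : Set C(X, ℝ)} {f₀ : C(X, ℝ)}

/-- The function induced by the reciprocal of a positive function. -/
noncomputable def liftInv (hf₀ : ∀ x, 0 < f₀ x) (hF : f₀ ∈ F) : C(TranslateQuotient G F, ℝ) where
  toFun z := (lift f₀ hF (1 : G) z)⁻¹
  continuous_toFun := (lift f₀ hF (1 : G)).continuous.inv₀
    (surjective_mk.forall.2 fun x => by simpa using (hf₀ x).ne')

@[simp]
theorem liftInv_mk (hf₀ : ∀ x, 0 < f₀ x) (hF : f₀ ∈ F) (x : X) :
    liftInv (G := G) hf₀ hF (mk G F x) = (f₀ x)⁻¹ := by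
  simp [liftInv]

theorem isProperMap_inv (hf₀ : ∀ x, 0 < f₀ x) (h : Tendsto f₀ (cocompact X) (𝓝 0)) :
    IsProperMap fun x => (f₀ x)⁻¹ := by
  refine isProperMap_iff_tendsto_cocompact.2
    ⟨f₀.continuous.inv₀ fun x => (hf₀ x).ne', ?_⟩
  refine Tendsto.mono_right ?_ atTop_le_cocompact
  exact Tendsto.inv_tendsto_nhdsGT_zero
    (tendsto_nhdsWithin_iff.2 ⟨h, Eventually.of_forall hf₀⟩)

/-- The reciprocal of `f₀` is proper and factors through the quotient when `f₀ ∈ F`; a first factor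
of a proper map, with Hausdorff middle space, is proper. -/
theorem isProperMap_mk (hf₀ : ∀ x, 0 < f₀ x) (h : Tendsto f₀ (cocompact X) (𝓝 0)) (hF : f₀ ∈ F) :
    IsProperMap (mk G F) := by
  refine isProperMap_of_comp_of_t2 continuous_mk (liftInv (G := G) hf₀ hF).continuous ?_
  convert isProperMap_inv hf₀ h using 1
  ext x
  simp

theorem isProperMap_liftInv (hf₀ : ∀ x, 0 < f₀ x) (h : Tendsto f₀ (cocompact X) (𝓝 0))
    (hF : f₀ ∈ F) : IsProperMap (liftInv (G := G) hf₀ hF) := by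
  refine isProperMap_of_comp_of_surj continuous_mk (liftInv (G := G) hf₀ hF).continuous ?_
    surjective_mk
  convert isProperMap_inv hf₀ h using 1
  ext x
  simp

/-- A continuous injection of the quotient through which `liftInv` factors is a closed
embedding. -/
theorem isClosedEmbedding_of_comp_eq (hf₀ : ∀ x, 0 < f₀ x) (h : Tendsto f₀ (cocompact X) (𝓝 0))
    (hF : f₀ ∈ F) {Z : Type*} [TopologicalSpace Z] [T2Space Z] {Φ : TranslateQuotient G F → Z}
    (hΦ : Continuous Φ) (hi : Function.Injective Φ) {q : Z → ℝ} (hq : Continuous q)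
    (hqΦ : ∀ z, q (Φ z) = liftInv hf₀ hF z) : IsClosedEmbedding Φ := by
  refine .of_continuous_injective_isClosedMap hΦ hi (IsProperMap.isClosedMap ?_)
  refine isProperMap_of_comp_of_t2 hΦ hq ?_
  convert isProperMap_liftInv (G := G) hf₀ h hF using 1
  exact funext hqΦ

theorem locallyCompactSpace (hf₀ : ∀ x, 0 < f₀ x) (h : Tendsto f₀ (cocompact X) (𝓝 0))
    (hF : f₀ ∈ F) : LocallyCompactSpace (TranslateQuotient G F) := by
  have : WeaklyLocallyCompactSpace (TranslateQuotient G F) := by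
    refine ⟨fun z => ⟨_, (isProperMap_liftInv (G := G) hf₀ h hF).isCompact_preimage
      (isCompact_closedBall (liftInv hf₀ hF z) 1), ?_⟩⟩
    exact (liftInv hf₀ hF).continuous.continuousAt.preimage_mem_nhds
      (Metric.closedBall_mem_nhds _ one_pos)
  infer_instance

theorem t35Space [SigmaCompactSpace X] (hf₀ : ∀ x, 0 < f₀ x)
    (h : Tendsto f₀ (cocompact X) (𝓝 0)) (hF : f₀ ∈ F) : T35Space (TranslateQuotient G F) := by
  have := locallyCompactSpace (G := G) hf₀ h hF
  have : SigmaCompactSpace (TranslateQuotient G F) := by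
    rw [← isSigmaCompact_univ_iff, ← surjective_mk.range_eq, ← image_univ]
    exact isSigmaCompact_univ.image continuous_mk
  infer_instance

/-- The quotient is locally compact Hausdorff, hence Baire, and it inherits transitivity from `X`,
so `F` may have any size. -/
theorem isOpenMap_mk_of_tendsto_cocompact [TopologicalSpace G] [IsTopologicalGroup G]
    (hG : IsOmegaNarrow G) [RegularSpace X] [MulAction.IsPretransitive G X]
    (ho : ∀ x : X, ContinuousAt (fun g : G => g • x) 1) (hf₀ : ∀ x, 0 < f₀ x)
    (h : Tendsto f₀ (cocompact X) (𝓝 0)) (hF : f₀ ∈ F) : IsOpenMap (mk G F) := by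
  have := locallyCompactSpace (G := G) hf₀ h hF
  exact isOpenMap_of_isClosedMap_of_equivariant hG ho (isProperMap_mk hf₀ h hF).isClosedMap
    fun _ _ => rfl

/-- Countably many coordinates separate points; the extra coordinate `liftInv` is proper and turns
the injection into a closed embedding. -/
theorem secondCountable_metrizable [TopologicalSpace G] (hG : IsOmegaNarrow G)
    (hf₀ : ∀ x, 0 < f₀ x) (h : Tendsto f₀ (cocompact X) (𝓝 0)) (hF : f₀ ∈ F) (hFc : F.Countable)
    (hFu : ∀ f ∈ F, IsOrbitUniform G f) : SecondCountableTopology (TranslateQuotient G F) ∧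
      TopologicalSpace.MetrizableSpace (TranslateQuotient G F) := by
  obtain ⟨ι, _, Φ, hΦ, hΦi⟩ := exists_continuous_injective hG hFc hFu
  have he : IsClosedEmbedding fun z => (Φ z, liftInv hf₀ hF z) :=
    isClosedEmbedding_of_comp_eq hf₀ h hF (hΦ.prodMk (liftInv hf₀ hF).continuous)
      (fun z z' hz => hΦi (congr_arg Prod.fst hz)) continuous_snd fun _ => rfl
  exact ⟨he.isEmbedding.secondCountableTopology, he.isEmbedding.metrizableSpace⟩

end TranslateQuotient

/-! ### The inverse system of stages -/

section Stage

variable {X : Type u} [TopologicalSpace X]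

/-- The rank of a function in a well-order of all continuous functions. -/
noncomputable def functionRank (f : C(X, ℝ)) : Ordinal.{u} :=
  Ordinal.typein (WellOrderingRel : C(X, ℝ) → C(X, ℝ) → Prop) f

theorem functionRank_injective : Function.Injective (functionRank : C(X, ℝ) → Ordinal.{u}) :=
  Ordinal.typein_injective _

variable (X) in
/-- An ordinal above the ranks of all functions. -/
noncomputable def topRank : Ordinal.{u} :=
  Ordinal.type (WellOrderingRel : C(X, ℝ) → C(X, ℝ) → Prop)

theorem functionRank_lt (f : C(X, ℝ)) : functionRank f < topRank X :=
  Ordinal.typein_lt_type _ f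

/-- The functions vanishing at infinity of rank less than `α`, together with `f₀`. -/
def stageFunctions (f₀ : C(X, ℝ)) (α : Ordinal.{u}) : Set C(X, ℝ) :=
  insert f₀ {f | Tendsto f (cocompact X) (𝓝 0) ∧ functionRank f < α}

variable {f₀ : C(X, ℝ)}

theorem mem_stageFunctions_self (α : Ordinal.{u}) : f₀ ∈ stageFunctions f₀ α := mem_insert _ _

theorem stageFunctions_mono : Monotone (stageFunctions f₀) := fun _ _ h =>
  insert_subset_insert fun _ hf => ⟨hf.1, hf.2.trans_le h⟩

variable {G : Type v} [Group G] [MulAction G X]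

open TranslateQuotient

/-- From `topRank X` on, all functions vanishing at infinity are present, and these separate points.
-/
theorem mk_stageFunctions_injective [T2Space X] [LocallyCompactSpace X] {α : Ordinal.{u}}
    (hα : topRank X ≤ α) : Function.Injective (mk G (stageFunctions f₀ α)) := by
  intro x y hxy
  by_contra hne
  obtain ⟨f, hf1, hf0, hfs, -⟩ := exists_continuous_one_zero_of_isCompact
    (isCompact_singleton (x := x)) (isClosed_singleton (x := y)) (by simpa using hne)
  have h1 := mk_eq_mk.1 hxy f (mem_insert_of_mem _
    ⟨hfs.is_zero_at_infty, (functionRank_lt f).trans_le hα⟩) 1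
  rw [one_smul, one_smul, hf1 rfl, hf0 rfl] at h1
  exact one_ne_zero h1

/-- The inverse system of the quotients given by the functions in `stageFunctions f₀ α`. -/
def stageSystem (G : Type v) [Group G] [MulAction G X] (f₀ : C(X, ℝ)) (τ : Ordinal.{u})
    (ht : ∀ α, T35Space (TranslateQuotient G (stageFunctions f₀ α))) :
    WellOrderedInverseSystem τ where
  obj α := TranslateQuotient G (stageFunctions f₀ α.1)
  tychonoff α := ht α.1
  map h := TranslateQuotient.map (stageFunctions_mono h)
  continuous_map h := TranslateQuotient.continuous_map (stageFunctions_mono h)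
  surjective_map h := TranslateQuotient.surjective_map (stageFunctions_mono h)
  map_self _ := surjective_mk.forall.2 fun _ => rfl
  map_map _ _ := surjective_mk.forall.2 fun _ => rfl

variable {τ : Ordinal.{u}} {ht : ∀ α, T35Space (TranslateQuotient G (stageFunctions f₀ α))}

theorem WellOrderedInverseSystem.Lim.ext {τ : Ordinal.{u}} {S : WellOrderedInverseSystem τ}
    {s : Set (Iio τ)} {x y : S.Lim s} (h : ∀ α, x.1 α = y.1 α) : x = y :=
  Subtype.ext (funext h)

theorem WellOrderedInverseSystem.Lim.continuous_apply {τ : Ordinal.{u}}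
    {S : WellOrderedInverseSystem τ} {s : Set (Iio τ)} (α : s) :
    Continuous fun x : S.Lim s => x.1 α :=
  (_root_.continuous_apply α).comp continuous_subtype_val

theorem WellOrderedInverseSystem.Lim.t2Space {τ : Ordinal.{u}} {S : WellOrderedInverseSystem τ}
    (s : Set (Iio τ)) : T2Space (S.Lim s) := by
  have := S.tychonoff
  exact inferInstanceAs (T2Space
    {x : ∀ α : s, S.obj α.1 // ∀ (α β : s) (h : α.1 ≤ β.1), S.map h (x β) = x α})

/-- Below a limit `γ`, each function of rank less than `γ` already occurs at the successor of its
rank, so nothing is lost in the limit. For density, finitely many coordinates of a thread are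
determined by the one of largest index, which comes from a point of `X`. -/
theorem stageSystem_almostContinuous [ContinuousConstSMul G X]
    (hf₀ : ∀ x, 0 < f₀ x) (h : Tendsto f₀ (cocompact X) (𝓝 0)) :
    (stageSystem G f₀ τ ht).AlmostContinuous := by
  intro γ hγ
  let zero : Iio γ := ⟨⟨0, hγ.bot_lt.trans γ.2⟩, hγ.bot_lt⟩
  have hcont : Continuous ((stageSystem G f₀ τ ht).toLimBelow γ) :=
    Continuous.subtype_mk (continuous_pi fun α =>
      (stageSystem G f₀ τ ht).continuous_map (le_of_lt α.2)) _
  have hmk : ∀ (x : X) (α : Iio γ), ((stageSystem G f₀ τ ht).toLimBelow γ (mk G _ x)).1 α =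
      mk G (stageFunctions f₀ α.1.1) x := fun _ _ => rfl
  have := WellOrderedInverseSystem.Lim.t2Space (S := stageSystem G f₀ τ ht) (Iio γ)
  refine ⟨(isClosedEmbedding_of_comp_eq hf₀ h (mem_stageFunctions_self γ.1) hcont ?_
    (q := fun x => liftInv (G := G) hf₀ (mem_stageFunctions_self 0) (x.1 zero)) ?_ ?_).isEmbedding, ?_⟩
  · refine surjective_mk.forall₂.2 fun x y hxy => ?_
    have hα : ∀ α : Iio γ, mk G (stageFunctions f₀ α.1.1) x = mk G (stageFunctions f₀ α.1.1) y :=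
      fun α => congr_arg (fun t => t.1 α) hxy
    refine mk_eq_mk.2 fun f hf => ?_
    rcases hf with rfl | ⟨hf, hfr⟩
    · exact mk_eq_mk.1 (hα zero) _ (mem_stageFunctions_self _)
    · have hs : Order.succ (functionRank f) < γ.1 := hγ.succ_lt hfr
      exact mk_eq_mk.1 (hα ⟨⟨Order.succ (functionRank f), hs.trans γ.2⟩, hs⟩) f
        (mem_insert_of_mem _ ⟨hf, Order.lt_succ _⟩)
  · exact (liftInv (G := G) hf₀ (mem_stageFunctions_self 0)).continuous.comp
      (WellOrderedInverseSystem.Lim.continuous_apply zero)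
  · refine surjective_mk.forall.2 fun x => ?_
    rw [hmk, liftInv_mk]
    exact (liftInv_mk hf₀ (mem_stageFunctions_self γ.1) x).symm
  · intro t
    refine mem_closure_iff.2 fun O hO htO => ?_
    obtain ⟨W, hW, rfl⟩ := isOpen_induced_iff.1 hO
    obtain ⟨I, u, hIu, hIW⟩ := isOpen_pi_iff.1 hW t.1 htO
    have : Nonempty (Iio γ) := ⟨zero⟩
    obtain ⟨β, hβ⟩ := I.exists_le
    obtain ⟨x, hx⟩ := surjective_mk (t.1 β)
    refine ⟨_, hIW fun α hα => ?_, ⟨mk G _ x, rfl⟩⟩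
    have h1 : ((stageSystem G f₀ τ ht).toLimBelow γ (mk G _ x)).1 α = t.1 α := by
      rw [← t.2 α β (hβ α hα), ← hx]
      rfl
    rw [h1]
    exact (hIu α hα).2

/-- At most one function has rank `α`. The metrizable factor is the quotient by that function
together with `f₀`, which keeps the quotient map proper. -/
theorem stageSystem_hasMetrizableKernel [TopologicalSpace G] [ContinuousConstSMul G X]
    (hG : IsOmegaNarrow G)
    (hu : ∀ f : C(X, ℝ), Tendsto f (cocompact X) (𝓝 0) → IsOrbitUniform G f)
    (hf₀ : ∀ x, 0 < f₀ x) (h : Tendsto f₀ (cocompact X) (𝓝 0)) {α β : Iio τ} (hαβ : α ≤ β)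
    (hβ : β.1 = Order.succ α.1) : HasMetrizableKernel ((stageSystem G f₀ τ ht).map hαβ) := by
  let F : Set C(X, ℝ) := insert f₀ {f | Tendsto f (cocompact X) (𝓝 0) ∧ functionRank f = α.1}
  have hFc : F.Countable := (Set.Subsingleton.countable fun f hf f' hf' =>
    functionRank_injective (hf.2.trans hf'.2.symm)).insert f₀
  have hFu : ∀ f ∈ F, IsOrbitUniform G f := by
    rintro f (rfl | hf)
    · exact hu _ h
    · exact hu f hf.1
  obtain ⟨_, _⟩ := secondCountable_metrizable hG hf₀ h (mem_insert _ _ : f₀ ∈ F) hFc hFu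
  have hFβ : F ⊆ stageFunctions f₀ β.1 := insert_subset_insert fun f hf =>
    ⟨hf.1, by rw [hβ, hf.2]; exact Order.lt_succ _⟩
  have : T35Space ((stageSystem G f₀ τ ht).obj α) := ht α.1
  refine ⟨TranslateQuotient G F, inferInstance, inferInstance, inferInstance,
    fun z => ((stageSystem G f₀ τ ht).map hαβ z, TranslateQuotient.map hFβ z),
    (isClosedEmbedding_of_comp_eq hf₀ h (mem_stageFunctions_self β.1)
      (((stageSystem G f₀ τ ht).continuous_map hαβ).prodMk (TranslateQuotient.continuous_map hFβ))
      ?_ (q := fun p => liftInv (G := G) hf₀ (mem_stageFunctions_self α.1) p.1)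
      ((liftInv (G := G) hf₀ (mem_stageFunctions_self α.1)).continuous.comp continuous_fst)
      (surjective_mk.forall.2 fun x => ?_)).isEmbedding, fun _ => rfl⟩
  · refine surjective_mk.forall₂.2 fun x y hxy => mk_eq_mk.2 fun f hf => ?_
    have h1 : mk G (stageFunctions f₀ α.1) x = mk G (stageFunctions f₀ α.1) y :=
      congr_arg Prod.fst hxy
    have h2 : mk G F x = mk G F y := congr_arg Prod.snd hxy
    rcases hf with rfl | ⟨hf, hfr⟩
    · exact mk_eq_mk.1 h2 _ (mem_insert _ _)
    · rw [hβ, Order.lt_succ_iff] at hfr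
      rcases hfr.lt_or_eq with hfr | hfr
      · exact mk_eq_mk.1 h1 f (mem_insert_of_mem _ ⟨hf, hfr⟩)
      · exact mk_eq_mk.1 h2 f (mem_insert_of_mem _ ⟨hf, hfr⟩)
  · rw [liftInv_mk]
    exact liftInv_mk _ _ _

/-- The canonical map to the limit of `stageSystem`. -/
def toStageLim (x : X) : (stageSystem G f₀ τ ht).FullLim :=
  ⟨fun α => mk G (stageFunctions f₀ α.1.1) x, fun _ _ _ => rfl⟩

theorem continuous_toStageLim :
    Continuous (toStageLim : X → (stageSystem G f₀ τ ht).FullLim) :=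
  Continuous.subtype_mk (continuous_pi fun _ => continuous_mk) _

variable [T2Space X] [LocallyCompactSpace X]

theorem stageSystem_isAlmostLimit [ContinuousConstSMul G X] (hf₀ : ∀ x, 0 < f₀ x)
    (h : Tendsto f₀ (cocompact X) (𝓝 0)) (hτ : topRank X < τ) :
    (stageSystem G f₀ τ ht).IsAlmostLimit X := by
  have := WellOrderedInverseSystem.Lim.t2Space (S := stageSystem G f₀ τ ht) univ
  let top : (univ : Set (Iio τ)) := ⟨⟨topRank X, hτ⟩, mem_univ _⟩
  refine ⟨toStageLim, ?_, fun α => surjective_mk⟩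
  refine (IsClosedEmbedding.of_continuous_injective_isClosedMap continuous_toStageLim ?_
    (IsProperMap.isClosedMap ?_)).isEmbedding
  · intro x y hxy
    exact mk_stageFunctions_injective (G := G) le_rfl
      (congr_arg (fun t : (stageSystem G f₀ τ ht).FullLim => t.1 top) hxy)
  · refine isProperMap_of_comp_of_t2 continuous_toStageLim
      (g := fun t => liftInv (G := G) hf₀ (mem_stageFunctions_self (topRank X)) (t.1 top))
      ((liftInv (G := G) hf₀ (mem_stageFunctions_self (topRank X))).continuous.comp
        (WellOrderedInverseSystem.Lim.continuous_apply top)) ?_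
    convert isProperMap_inv hf₀ h using 1
    ext x
    exact liftInv_mk _ _ _

/-- By stage `topRank X` the classes are points, so a thread is determined by its coordinate there
and comes from a point of `X`. -/
theorem stageSystem_factorizing (hτ : topRank X < τ) :
    (stageSystem G f₀ τ ht).Factorizing := by
  intro f hf _
  let top : Iio τ := ⟨topRank X, hτ⟩
  let e : X → (stageSystem G f₀ τ ht).FullLim := toStageLim
  have hinj : Function.Injective (mk G (stageFunctions f₀ (topRank X))) :=
    mk_stageFunctions_injective le_rfl
  let r : TranslateQuotient G (stageFunctions f₀ (topRank X)) → X :=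
    Function.surjInv surjective_mk
  have hmr : ∀ z, mk G (stageFunctions f₀ (topRank X)) (r z) = z :=
    Function.surjInv_eq surjective_mk
  have hrm : ∀ x, r (mk G (stageFunctions f₀ (topRank X)) x) = x := fun x => hinj (hmr _)
  refine ⟨top, fun z => f (e (r z)), ?_, fun t => ?_⟩
  · refine isQuotientMap_mk.continuous_iff.2 ?_
    have h1 : (fun z => f (e (r z))) ∘ mk G (stageFunctions f₀ (topRank X)) = f ∘ e := by
      ext x
      simp only [Function.comp, hrm]
    exact h1 ▸ hf.comp continuous_toStageLim
  · congr 1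
    refine WellOrderedInverseSystem.Lim.ext fun α => ?_
    let x := r (t.1 ⟨top, mem_univ _⟩)
    have hx : mk G (stageFunctions f₀ (topRank X)) x = t.1 ⟨top, mem_univ _⟩ := hmr _
    change t.1 α = mk G (stageFunctions f₀ α.1.1) x
    rcases le_total α.1 top with hα | hα
    · rw [← t.2 α ⟨top, mem_univ _⟩ hα, ← hx]
      rfl
    · obtain ⟨y, hy⟩ := surjective_mk (t.1 α)
      have h1 := t.2 ⟨top, mem_univ _⟩ α hα
      rw [← hy, ← hx] at h1
      have h2 : y = x := hinj (h1 : mk G (stageFunctions f₀ (topRank X)) y = mk G _ x)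
      exact h2 ▸ hy.symm

/-- A locally compact `σ`-compact space with a continuous transitive action of an `ω`-narrow group
is openly Dugundji. -/
theorem isOpenlyDugundji_of_transitive [TopologicalSpace G] [IsTopologicalGroup G]
    [T35Space X] [SigmaCompactSpace X] [ContinuousConstSMul G X] [MulAction.IsPretransitive G X]
    (hG : IsOmegaNarrow G) (hcont : Continuous fun p : G × X => p.1 • p.2) : IsOpenlyDugundji X := by
  obtain ⟨f₀, hf₀, h⟩ := exists_pos_tendsto_cocompact (X := X)
  have hu : ∀ f : C(X, ℝ), Tendsto f (cocompact X) (𝓝 0) → IsOrbitUniform G f := fun f hf =>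
    isOrbitUniform_of_tendsto_cocompact hcont hf
  have ht : ∀ α, T35Space (TranslateQuotient G (stageFunctions f₀ α)) := fun α =>
    t35Space hf₀ h (mem_stageFunctions_self α)
  -- A successor cardinal places `topRank X` strictly below `τ`, so that the stage equal to `X`
  -- belongs to the system.
  have hτ : topRank X < (Order.succ (topRank X).card).ord :=
    Cardinal.lt_ord.2 (Order.lt_succ _)
  refine ⟨inferInstance, Order.succ (topRank X).card,
    (zero_le.trans_lt (Order.lt_succ _)).ne', stageSystem G f₀ _ ht, ?_, ?_,
    fun α β hαβ hβ => stageSystem_hasMetrizableKernel hG hu hf₀ h hαβ hβ,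
    stageSystem_almostContinuous hf₀ h, stageSystem_isAlmostLimit hf₀ h hτ,
    stageSystem_factorizing hτ⟩
  · intro α β hαβ
    refine isOpenMap_map (stageFunctions_mono hαβ) (isOpenMap_mk_of_tendsto_cocompact hG
      (fun x => ?_) hf₀ h (mem_stageFunctions_self _))
    have h1 : Continuous fun g : G => g • x := by
      exact hcont.comp (Continuous.prodMk continuous_id continuous_const)
    exact h1.continuousAt
  · intro α hα
    have h0 : stageFunctions f₀ α.1 = {f₀} := by
      rw [hα, stageFunctions]
      simp
    obtain ⟨h1, h2⟩ := secondCountable_metrizable hG hf₀ h (mem_stageFunctions_self α.1)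
      (h0 ▸ countable_singleton f₀) (fun f hf => by
        rw [h0] at hf
        exact (mem_singleton_iff.1 hf) ▸ hu f₀ h)
    have h3 : TopologicalSpace.SeparableSpace (TranslateQuotient G (stageFunctions f₀ α.1)) :=
      inferInstance
    exact ⟨h3, h2⟩

end Stage

/-! ### The Čech-complete case and the conclusion -/

/-- Čech-complete spaces are Baire. -/
theorem IsCechComplete.baireSpace {X : Type u} [TopologicalSpace X] (hX : IsCechComplete X) :
    BaireSpace X := by
  obtain ⟨_, h⟩ := hX
  have := h.baireSpace_of_t2Space_locallyCompactSpace
  exact (isEmbedding_stoneCechUnit (X := X)).toHomeomorph.symm.baireSpace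

theorem proposition1p6 (G : Type v) [Group G] [TopologicalSpace G] [IsTopologicalGroup G]
    [T2Space G] (hG : IsOmegaNarrow G)
    (X : Type u) [TopologicalSpace X] [T35Space X] [Nonempty X]
    [MulAction G X] [MulAction.IsPretransitive G X]
    (hsc : IsSeparatelyContinuousAction G X) :
    (IsPseudocompact X →
      (Continuous fun p : G × X => p.1 • p.2) ∧ IsDugundji (StoneCech X)) ∧
    (IsCechComplete X → SigmaCompactSpace X →
      (Continuous fun p : G × X => p.1 • p.2) ∧ IsOpenlyDugundji X) := by
  have : ContinuousConstSMul G X := ⟨hsc.1⟩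
  refine ⟨fun hX => ?_, fun hX _ => ?_⟩
  · have := baireSpace_of_forall_bounded hX.2
    have hn : ∀ U ∈ 𝓝 (1 : G), ∀ x : X, closure ((fun g : G => g • x) '' U) ∈ 𝓝 x :=
      fun U hU x => closure_orbit_mem_nhds hG hU x
    exact ⟨continuous_smul_of_closure_orbit_mem_nhds hsc.1 hsc.2 hn,
      isDugundji_stoneCech_of_transitive hG hX.2 hsc.2 hn⟩
  · have := hX.baireSpace
    have := weaklyLocallyCompactSpace_of_sigmaCompactSpace (G := G) (X := X)
    have hcont := continuous_smul_of_closure_orbit_mem_nhds hsc.1 hsc.2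
      fun U hU x => closure_orbit_mem_nhds hG hU x
    exact ⟨hcont, isOpenlyDugundji_of_transitive hG hcont⟩
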